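/- Let $N\ge 2$ and let $E,F$ be (algebraic) vector bundles on $\mathbb P^N=\mathbb P^N_{\mathbb C}$ satisfying the following basic hypotheses: $E$ and $F$ are simple, i.e. $\operatorname{Hom}(E,E)=\mathbb C$ and $\operatorname{Hom}(F,F)=\mathbb C$; $\operatorname{Hom}(F,E)=\operatorname{Ext}^1(F,E)=0$; the sheaf $E^*\otimes F$ is globally generated; and the vector space $W=\operatorname{Hom}(E,F)$ has dimension $w\ge 3$. Then there exist vector bundles $C_0=E,\ C_1=F,\ C_2,\ C_3,\dots$ on $\mathbb P^N$ and, for every $n\ge 1$, a short exact sequence $$0\to C_{n-1}\xrightarrow{\ i_n\ } C_n\otimes W^*\xrightarrow{\ p_n\ } C_{n+1}\to 0\quad\text{if $n$ is odd},$$ $$0\to C_{n-1}\xrightarrow{\ i_n\ } C_n\otimes W\xrightarrow{\ p_n\ } C_{n+1}\to 0\quad\text{if $n$ is even},$$ where the maps $i_n$ are given recursively as follows. * $i_1:E\to F\otimes W^*=F\otimes\operatorname{Hom}(E,F)^*$ is the canonical map, $e\mapsto\sum_{j} e_j(e)\otimes e_j^*$ for a basis $e_1,\dots,e_w$ of $W$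 with dual basis $e_1^*,\dots,e_w^*$. * For $n\ge 2$, $i_n=(p_{n-1}\otimes \mathrm{id})\circ(\mathrm{id}\otimes d)$, i.e. $i_n$ is the composition $$C_{n-1}=C_{n-1}\otimes\mathbb C\to C_{n-1}\otimes W^*\otimes W\to C_n\otimes W\quad(n\text{ even}),$$ $$C_{n-1}=C_{n-1}\otimes\mathbb C\to C_{n-1}\otimes W\otimes W^*\to C_n\otimes W^*\quad(n\text{ odd}),$$ where $d$ is the diagonal map, $d(1)=\sum_j e_j\otimes e_j^*$ (with the two factors in the order required by the target). Moreover each $i_n$ is an injective bundle map: it is injective on the fibre at every point of $\mathbb P^N$. -/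

import Mathlib

open CategoryTheory CategoryTheory.Limits AlgebraicGeometry
open scoped TensorProduct

-- so that `X ⟶ Y` always refers to the hom-sets of the category structure itself
attribute [-instance] CategoryTheory.catToReflQuiver

namespace FibonacciBundle

noncomputable section

section Linear

variable {X : Scheme.{0}}

/-- Multiplication by a global function `r ∈ Γ(X, 𝒪_X)` on an `𝒪_X`-module. -/
def globalMul (r : Γ(X, ⊤)) (M : X.Modules) : M ⟶ M :=
  (Scheme.Modules.fullyFaithfulToPresheafOfModules (X := X)).preimage
    { app := fun U => ModuleCat.ofHom
        (X := M.val.obj U) (Y := M.val.obj U)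
        { toFun := fun s =>
            (show Γ(M, U.unop) from (X.presheaf.map (homOfLE le_top).op r) •
              (show Γ(M, U.unop) from s))
          map_add' := fun s t => smul_add (M := Γ(X, U.unop)) (A := Γ(M, U.unop)) _ s t
          map_smul' := fun a s => by
            exact smul_comm (M := Γ(X, U.unop)) (N := Γ(X, U.unop)) (α := Γ(M, U.unop)) _ a s }
      naturality := by
        intro U V f
        ext s
        change (show Γ(X, V.unop) from X.presheaf.map (homOfLE le_top).op r) •
            (show Γ(M, V.unop) from M.presheaf.map f (show Γ(M, U.unop) from s)) =
          M.presheaf.map f.unop.op ((show Γ(X, U.unop) from X.presheaf.map (homOfLE le_top).op r) •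
            (show Γ(M, U.unop) from s))
        refine Eq.trans ?_ (Scheme.Modules.map_smul M f.unop _ _).symm
        congr 1
        rw [← CommRingCat.comp_apply, ← Functor.map_comp]
        rfl }

lemma globalMul_app (r : Γ(X, ⊤)) (M : X.Modules) (U : X.Opens) (s : Γ(M, U)) :
    (globalMul r M).app U s = (X.presheaf.map (homOfLE le_top).op r : Γ(X, U)) • s := rfl

lemma globalMul_add (r r' : Γ(X, ⊤)) (M : X.Modules) :
    globalMul (r + r') M = globalMul r M + globalMul r' M := by
  ext U s
  rw [globalMul_app, Scheme.Modules.Hom.add_app]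
  change _ = (globalMul r M).app U s + (globalMul r' M).app U s
  rw [globalMul_app, globalMul_app, map_add, add_smul]

lemma globalMul_mul (r r' : Γ(X, ⊤)) (M : X.Modules) :
    globalMul (r * r') M = globalMul r' M ≫ globalMul r M := by
  ext U s
  change _ = (globalMul r M).app U ((globalMul r' M).app U s)
  rw [globalMul_app, globalMul_app, globalMul_app, map_mul, mul_smul]

lemma globalMul_one (M : X.Modules) : globalMul (1 : Γ(X, ⊤)) M = 𝟙 M := by
  ext U s
  rw [globalMul_app, map_one, one_smul]
  rfl

lemma globalMul_zero (M : X.Modules) : globalMul (0 : Γ(X, ⊤)) M = 0 := by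
  ext U s
  rw [globalMul_app, map_zero, zero_smul]
  rfl

lemma globalMul_comm (r : Γ(X, ⊤)) {M N : X.Modules} (f : M ⟶ N) :
    globalMul r M ≫ f = f ≫ globalMul r N := by
  ext U s
  change f.app U ((globalMul r M).app U s) = (globalMul r N).app U (f.app U s)
  rw [globalMul_app, globalMul_app, Scheme.Modules.Hom.app_smul]

/-- A ring homomorphism `ℂ → Γ(X, 𝒪_X)` makes the category of `𝒪_X`-modules `ℂ`-linear: a scalar
acts on sections through the corresponding function. -/
@[reducible]
def linearOfRingHom (σ : ℂ →+* Γ(X, ⊤)) : Linear ℂ X.Modules where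
  homModule M N :=
    { smul := fun c f => f ≫ globalMul (σ c) N
      one_smul := fun f => by
        change f ≫ globalMul (σ 1) N = f
        rw [map_one, globalMul_one, Category.comp_id]
      mul_smul := fun c d f => by
        change f ≫ globalMul (σ (c * d)) N = (f ≫ globalMul (σ d) N) ≫ globalMul (σ c) N
        rw [map_mul, globalMul_mul, Category.assoc]
      smul_zero := fun c => by
        change (0 : M ⟶ N) ≫ globalMul (σ c) N = 0
        rw [zero_comp]
      smul_add := fun c f g => by
        change (f + g) ≫ globalMul (σ c) N = f ≫ globalMul (σ c) N + g ≫ globalMul (σ c) N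
        rw [Preadditive.add_comp]
      add_smul := fun c d f => by
        change f ≫ globalMul (σ (c + d)) N = f ≫ globalMul (σ c) N + f ≫ globalMul (σ d) N
        rw [map_add, globalMul_add, Preadditive.comp_add]
      zero_smul := fun f => by
        change f ≫ globalMul (σ 0) N = 0
        rw [map_zero, globalMul_zero, comp_zero] }
  smul_comp M N K c f g := by
    change (f ≫ globalMul (σ c) N) ≫ g = (f ≫ g) ≫ globalMul (σ c) K
    rw [Category.assoc, globalMul_comm, Category.assoc]
  comp_smul M N K f c g := by
    change f ≫ g ≫ globalMul (σ c) K = (f ≫ g) ≫ globalMul (σ c) K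
    rw [Category.assoc]

end Linear

section ProjectiveSpace

attribute [local instance] MvPolynomial.gradedAlgebra

/-- Projective space `ℙ^N = Proj ℂ[x₀, …, x_N]` over `ℂ`. -/
abbrev PP (N : ℕ) : Scheme.{0} :=
  Proj (MvPolynomial.homogeneousSubmodule (Fin (N + 1)) ℂ)

/-- The structure morphism `ℙ^N → Spec ℂ`. -/
def structureMap (N : ℕ) : PP N ⟶ Spec (CommRingCat.of ℂ) :=
  Proj.toSpecZero (MvPolynomial.homogeneousSubmodule (Fin (N + 1)) ℂ) ≫
    Spec.map (CommRingCat.ofHom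
      (algebraMap ℂ (MvPolynomial.homogeneousSubmodule (Fin (N + 1)) ℂ 0)))

/-- Complex numbers as constant global functions on `ℙ^N`. -/
def constants (N : ℕ) : ℂ →+* Γ(PP N, ⊤) :=
  ((Scheme.ΓSpecIso (CommRingCat.of ℂ)).inv ≫ (structureMap N).appTop).hom

/-- The `ℂ`-linear structure on `𝒪`-modules on `ℙ^N`; in particular `Hom(E, F)` is a complex
vector space. -/
instance linearPP (N : ℕ) : Linear ℂ (PP N).Modules := linearOfRingHom (constants N)

end ProjectiveSpace

section Bundles

variable {X : Scheme.{0}}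

/-- Restriction of a section of `M` from `V` to a smaller open set. -/
abbrev res {M : X.Modules} {V V' : X.Opens} (h : V' ≤ V) (s : Γ(M, V)) : Γ(M, V') :=
  M.presheaf.map (homOfLE h).op s

/-- Restriction of a function from `V` to a smaller open set. -/
abbrev resFun {V V' : X.Opens} (h : V' ≤ V) (g : Γ(X, V)) : Γ(X, V') :=
  X.presheaf.map (homOfLE h).op g

/-- The sections `s₁, …, s_r` of `M` over `U` form a frame: they define an isomorphism
`𝒪_U^r ≅ M|_U`, that is, they are a basis of the sections over every open subset of `U`. -/
def IsFrame {M : X.Modules} {U : X.Opens} {r : ℕ} (s : Fin r → Γ(M, U)) : Prop :=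
  ∀ (V : X.Opens) (h : V ≤ U),
    LinearIndependent Γ(X, V) (fun j => res h (s j)) ∧
      Submodule.span Γ(X, V) (Set.range fun j => res h (s j)) = ⊤

/-- Algebraic vector bundles, as locally free sheaves of finite rank. -/
def IsVectorBundle (M : X.Modules) : Prop :=
  ∀ x : X, ∃ (U : X.Opens) (_ : x ∈ U) (r : ℕ) (s : Fin r → Γ(M, U)), IsFrame s

/-- The value of the section `s` in the fibre `M_x / 𝔪_x M_x` at `x` is zero: near `x`, the section
is a linear combination of sections of `M` with coefficients that vanish at `x`. -/
def VanishesAt {M : X.Modules} {U : X.Opens} (s : Γ(M, U)) (x : X) : Prop :=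
  ∃ (V : X.Opens) (h : V ≤ U) (_ : x ∈ V) (m : ℕ) (g : Fin m → Γ(X, V)) (t : Fin m → Γ(M, V)),
    (∀ j, x ∉ X.basicOpen (g j)) ∧ res h s = ∑ j, g j • t j

/-- The morphism `φ` is injective on the fibre at every point, i.e. it is an injective bundle
map. (Every element of a fibre is the value of a section over some neighbourhood.) -/
def IsInjectiveBundleMap {M N : X.Modules} (φ : M ⟶ N) : Prop :=
  ∀ (x : X) (U : X.Opens) (_ : x ∈ U) (s : Γ(M, U)), VanishesAt (φ.app U s) x → VanishesAt s x

/-- Global generation of the sheaf `E* ⊗ F = ℋom(E, F)` (for bundles `E`, `F`): every local section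
of it, i.e. every morphism `φ : E|_U → F|_U`, is near each point `x` of `U` a linear combination,
with regular functions as coefficients, of global sections, i.e. of morphisms `E → F`. -/
def DualTensorGloballyGenerated (E F : X.Modules) : Prop :=
  ∀ (U : X.Opens) (φ : E.restrict U.ι ⟶ F.restrict U.ι) (x : (U : Scheme.{0})),
    ∃ (V : (U : Scheme.{0}).Opens) (_ : x ∈ V) (m : ℕ) (f : Fin m → (E ⟶ F))
      (g : Fin m → Γ((U : Scheme.{0}), V)),
      ∀ (V' : (U : Scheme.{0}).Opens) (h : V' ≤ V) (e : Γ(E.restrict U.ι, V')),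
        φ.app V' e =
          ∑ j, resFun h (g j) • ((Scheme.Modules.restrictFunctor U.ι).map (f j)).app V' e

/-- The vanishing of `Ext¹(F, E)`, in the abelian category of `𝒪_X`-modules. -/
def ExtOneVanishes (F E : X.Modules) : Prop :=
  letI := HasExt.standard X.Modules
  Subsingleton (Abelian.Ext F E 1)

end Bundles

section Hypotheses

variable {N : ℕ}

/-- A bundle is simple if its only endomorphisms are the scalars, `Hom(E, E) = ℂ`. -/
def IsSimple (E : (PP N).Modules) : Prop := Module.finrank ℂ (E ⟶ E) = 1

/-- The basic hypotheses on a pair of vector bundles `(E, F)` on `ℙ^N`. -/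
structure BasicHypotheses (E F : (PP N).Modules) : Prop where
  bundle_left : IsVectorBundle E
  bundle_right : IsVectorBundle F
  simple_left : IsSimple E
  simple_right : IsSimple F
  hom_eq_zero : ∀ f : F ⟶ E, f = 0
  ext_eq_zero : ExtOneVanishes F E
  globally_generated : DualTensorGloballyGenerated E F
  three_le_dim : 3 ≤ Module.finrank ℂ (E ⟶ F)

end Hypotheses

section Tensor

variable {N : ℕ}

instance hasFiniteBiproducts_modules : HasFiniteBiproducts (PP N).Modules :=
  Abelian.hasFiniteBiproducts

/-- The tensor product `C ⊗ A` of an `𝒪`-module with a finite-dimensional vector space, realised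
as a direct sum of `dim A` copies of `C` through a basis of `A`. The map `tensorMk` makes it
independent of the basis. -/
abbrev tensor (C : (PP N).Modules) (A : Type) [AddCommGroup A] [Module ℂ A] [FiniteDimensional ℂ A] :
    (PP N).Modules :=
  ⨁ fun _ : Fin (Module.finrank ℂ A) => C

/-- The map `a ↦ (c ↦ c ⊗ a)`, from `A` to `Hom(C, C ⊗ A)`. -/
def tensorMk (C : (PP N).Modules) (A : Type) [AddCommGroup A] [Module ℂ A]
    [FiniteDimensional ℂ A] : A →ₗ[ℂ] (C ⟶ tensor C A) :=
  (Module.finBasis ℂ A).constr ℂ fun j => biproduct.ι (fun _ : Fin (Module.finrank ℂ A) => C) j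

/-- The universal property of `C ⊗ A`: linear maps `A → Hom(C, D)` are the same as morphisms
`C ⊗ A → D`. -/
theorem tensor_universal (C D : (PP N).Modules) (A : Type) [AddCommGroup A] [Module ℂ A]
    [FiniteDimensional ℂ A] (θ : A →ₗ[ℂ] (C ⟶ D)) :
    ∃! f : tensor C A ⟶ D, ∀ a, tensorMk C A a ≫ f = θ a := by
  have key : ∀ f : tensor C A ⟶ D, (∀ a, tensorMk C A a ≫ f = θ a) ↔
      ∀ j, biproduct.ι (fun _ : Fin (Module.finrank ℂ A) => C) j ≫ f =
        θ (Module.finBasis ℂ A j) := by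
    intro f
    constructor
    · intro h j
      rw [← h, tensorMk, Module.Basis.constr_basis]
    · intro h
      have : (Linear.rightComp ℂ C f).comp (tensorMk C A) = θ := by
        refine (Module.finBasis ℂ A).ext fun j => ?_
        simp only [LinearMap.comp_apply, Linear.rightComp_apply]
        rw [tensorMk, Module.Basis.constr_basis, h]
      exact fun a => congr($this a)
  refine ⟨biproduct.desc fun j => θ (Module.finBasis ℂ A j), (key _).2 ?_, ?_⟩
  · intro j
    exact biproduct.ι_desc _ _
  · intro f hf
    refine biproduct.hom_ext' _ _ fun j => ?_
    rw [(key f).1 hf j]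
    rw [biproduct.ι_desc]

/-- The morphism `f ⊗ id : C ⊗ A → D ⊗ A`. -/
def tensorMap {C D : (PP N).Modules} (f : C ⟶ D) (A : Type) [AddCommGroup A] [Module ℂ A]
    [FiniteDimensional ℂ A] : tensor C A ⟶ tensor D A :=
  biproduct.map fun _ => f

/-- `f ⊗ id` sends `c ⊗ a` to `f c ⊗ a`. -/
theorem tensorMk_tensorMap {C D : (PP N).Modules} (f : C ⟶ D) (A : Type) [AddCommGroup A]
    [Module ℂ A] [FiniteDimensional ℂ A] (a : A) :
    tensorMk C A a ≫ tensorMap f A = f ≫ tensorMk D A a := by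
  have : (Linear.rightComp ℂ C (tensorMap f A)).comp (tensorMk C A) =
      (Linear.leftComp ℂ (tensor D A) f).comp (tensorMk D A) := by
    refine (Module.finBasis ℂ A).ext fun j => ?_
    simp only [LinearMap.comp_apply, Linear.rightComp_apply, Linear.leftComp_apply]
    rw [tensorMk, tensorMk, Module.Basis.constr_basis, Module.Basis.constr_basis]
    exact biproduct.ι_map (fun _ : Fin (Module.finrank ℂ A) => f) j
  exact congr($this a)

/-- For `t = ∑ a ⊗ b` in `A ⊗ B`, the morphism `id ⊗ t : C = C ⊗ ℂ → C ⊗ A ⊗ B`,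
`c ↦ ∑ c ⊗ a ⊗ b`. -/
def tensorElement (C : (PP N).Modules) {A B : Type} [AddCommGroup A] [Module ℂ A]
    [FiniteDimensional ℂ A] [AddCommGroup B] [Module ℂ B] [FiniteDimensional ℂ B]
    (t : A ⊗[ℂ] B) : C ⟶ tensor (tensor C A) B :=
  TensorProduct.lift
    ((CategoryTheory.Linear.comp (S := ℂ) C (tensor C A) (tensor (tensor C A) B)).compl₁₂
      (tensorMk C A) (tensorMk (tensor C A) B)) t

/-- The canonical map `E → F ⊗ Hom(E, F)*`, `e ↦ ∑ w_i(e) ⊗ w_i*`, for a basis `w_i` of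
`Hom(E, F)` and its dual basis `w_i*`. -/
def canonicalMap (E F : (PP N).Modules) [FiniteDimensional ℂ (E ⟶ F)] :
    E ⟶ tensor F (Module.Dual ℂ (E ⟶ F)) :=
  TensorProduct.lift
    ((CategoryTheory.Linear.comp (S := ℂ) E F (tensor F (Module.Dual ℂ (E ⟶ F)))).compl₁₂
      LinearMap.id (tensorMk F (Module.Dual ℂ (E ⟶ F))))
    (coevaluation ℂ (E ⟶ F) 1)

/-- The sequence of vector spaces `W, W*, W, W*, …` where `W = Hom(E, F)`: the `n`-th one is `W`
for even `n` and `W*` for odd `n`. -/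
def mutSpace (E F : (PP N).Modules) : ℕ → ModuleCat.{0} ℂ
  | 0 => ModuleCat.of ℂ (E ⟶ F)
  | 1 => ModuleCat.of ℂ (Module.Dual ℂ (E ⟶ F))
  | n + 2 => mutSpace E F n

lemma mutSpace_of_even (E F : (PP N).Modules) {n : ℕ} (hn : Even n) :
    mutSpace E F n = ModuleCat.of ℂ (E ⟶ F) := by
  induction n using Nat.twoStepInduction with
  | zero => rfl
  | one => exact absurd hn (by decide)
  | more n ih _ => exact ih (by simpa [Nat.even_add] using hn)

lemma mutSpace_of_odd (E F : (PP N).Modules) {n : ℕ} (hn : Odd n) :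
    mutSpace E F n = ModuleCat.of ℂ (Module.Dual ℂ (E ⟶ F)) := by
  induction n using Nat.twoStepInduction with
  | zero => exact absurd hn (by decide)
  | one => rfl
  | more n ih _ => exact ih (by simpa [Nat.odd_add] using hn)

instance finiteDimensional_mutSpace (E F : (PP N).Modules) [h : FiniteDimensional ℂ (E ⟶ F)] :
    ∀ n, FiniteDimensional ℂ (mutSpace E F n)
  | 0 => h
  | 1 => inferInstanceAs (FiniteDimensional ℂ (Module.Dual ℂ (E ⟶ F)))
  | n + 2 => finiteDimensional_mutSpace E F n

/-- The diagonal element `∑ w_i ⊗ w_i*` of `W ⊗ W*` (for even `n`), resp. `∑ w_i* ⊗ w_i` of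
`W* ⊗ W` (for odd `n`): the image of `1` under the diagonal map. -/
def diagonal (E F : (PP N).Modules) [FiniteDimensional ℂ (E ⟶ F)] :
    ∀ n, mutSpace E F n ⊗[ℂ] mutSpace E F (n + 1)
  | 0 => coevaluation ℂ (E ⟶ F) 1
  | 1 => TensorProduct.comm ℂ (E ⟶ F) (Module.Dual ℂ (E ⟶ F)) (coevaluation ℂ (E ⟶ F) 1)
  | n + 2 => diagonal E F n

end Tensor

end

end FibonacciBundle

/-! The bundle C_{n+2} is defined as the cokernel of i_{n+1}, so the content is that every i_n is
injective on fibres. Fix a point x, let V_n be the fibre of C_n at x, and choose dual bases of W and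
W*. Their elements act by maps T_{n,j} : V_n → V_{n+1}. In these coordinates i_{n+1} is c ↦ (T_{n,j}
c)_j and p_{n+1} is (d_j) ↦ ∑ T_{n+1,j} d_j. Taking fibres is right exact, so V_n → V_{n+1}^w →
V_{n+2} is exact in the middle before any injectivity is known.

Suppose that a nonzero c in V_m, m ≥ 1, is killed by all T_{m,j}. Put P_{m+1} = 0, let P_m be the
line through c, and for k < m let P_k be the space of vectors that all T_{k,j} send into P_{k+1}.
Exactness gives w · dim P_{k+1} ≤ dim P_k + dim P_{k+2}. Since w ≥ 3, the dimensions at least double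
at each step down, and dim P_{m-1} ≥ w already. Hence dim V_0 ≥ w
(`eq_zero_of_forall_eq_zero_of_exact`).

This contradicts rk E < w (`finrank_fib_left_lt`). Global generation says that W spans Hom(E_x,
F_x), so i_1 is injective on fibres and rk E · rk F ≤ w. If rk E ≥ w, then F has rank 1, rk E = w
and i_1 is an isomorphism from E to F ⊗ W*, whose inverse gives nonzero maps F → E.

Injectivity on fibres yields the rest: locally a frame of the source extends to a frame of the
target, so the map is a monomorphism and its cokernel is again a vector bundle. -/

open TopologicalSpace (Opens)

namespace FibonacciBundle

noncomputable section

/-! ### Dimension growth along chains of exact sequences of vector spaces -/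

section LinearAlgebra

variable {K : Type*} [Field K]

/-- Summing the `T j` maps P^J to Q, with kernel of dimension at least |J| dim P − dim Q. By
exactness each element of this kernel comes from A, necessarily from a vector that every `S j` sends
into P. -/
lemma card_mul_finrank_le_finrank_comap_add {J A B D : Type*} [Fintype J] [AddCommGroup A]
    [Module K A] [AddCommGroup B] [Module K B] [AddCommGroup D] [Module K D]
    [FiniteDimensional K A] [FiniteDimensional K B] [FiniteDimensional K D]
    (S : J → A →ₗ[K] B) (T : J → B →ₗ[K] D)
    (hex : ∀ d : J → B, ∑ j, T j (d j) = 0 → ∃ c, ∀ j, S j c = d j)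
    (P : Submodule K B) (Q : Submodule K D) (hPQ : ∀ j, ∀ b ∈ P, T j b ∈ Q) :
    Fintype.card J * Module.finrank K P ≤
      Module.finrank K
        ((Submodule.pi Set.univ fun _ : J => P).comap (LinearMap.pi S)) + Module.finrank K Q := by
  let U := (Submodule.pi Set.univ fun _ : J => P).comap (LinearMap.pi S)
  let f : (J → P) →ₗ[K] Q := ∑ j, ((T j).restrict (hPQ j)).comp (LinearMap.proj j)
  have hf : ∀ d, ((f d : Q) : D) = ∑ j, T j (d j) := fun d => by
    simp [f, LinearMap.sum_apply]
  have h₁ := f.finrank_range_add_finrank_ker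
  have h₂ : Module.finrank K (LinearMap.range f) ≤ Module.finrank K Q := Submodule.finrank_le _
  have h₃ : Module.finrank K (LinearMap.ker f) ≤ Module.finrank K U := by
    let ρ : U →ₗ[K] (J → P) := LinearMap.pi fun j =>
      (S j).restrict (p := U) (q := P) fun a ha => ha j (Set.mem_univ j)
    have : LinearMap.ker f ≤ LinearMap.range ρ := by
      intro d hd
      obtain ⟨c, hc⟩ := hex (fun j => d j) (by rw [← hf, LinearMap.mem_ker.1 hd]; rfl)
      refine ⟨⟨c, fun j _ => ?_⟩, ?_⟩
      · simp only [LinearMap.pi_apply, hc]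
        exact (d j).2
      · ext j
        exact hc j
    exact (Submodule.finrank_mono this).trans ρ.finrank_range_le
  rw [Module.finrank_pi_fintype] at h₁
  simp only [Finset.sum_const, Finset.card_univ, smul_eq_mul] at h₁
  change _ ≤ Module.finrank K U + _
  omega

/-- If the sequences `V n → V (n + 1) ^ J → V (n + 2)` are exact and `dim V 0 < |J|`, then the maps
`V n → V (n + 1) ^ J` are injective for `n ≥ 1`. -/
lemma eq_zero_of_forall_eq_zero_of_exact {J : Type*} [Fintype J] (hJ : 3 ≤ Fintype.card J)
    (V : ℕ → Type*) [∀ n, AddCommGroup (V n)] [∀ n, Module K (V n)]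
    [∀ n, FiniteDimensional K (V n)] (T : ∀ n, J → V n →ₗ[K] V (n + 1))
    (n : ℕ) (hex : ∀ k ≤ n, ∀ d : J → V (k + 1), ∑ j, T (k + 1) j (d j) = 0 →
      ∃ c, ∀ j, T k j c = d j)
    (hV : Module.finrank K (V 0) < Fintype.card J) (c : V (n + 1))
    (hc : ∀ j, T (n + 1) j c = 0) : c = 0 := by
  by_contra hne
  -- Descending induction on k. The bound 2 dim Q ≤ dim P reproduces itself: the next space has
  -- dimension at least |J| dim P − dim P / 2, which is at least 2 dim P because |J| ≥ 3.
  have key : ∀ m k, k + m = n → ∃ (P : Submodule K (V k)) (Q : Submodule K (V (k + 1))),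
      (∀ j, ∀ b ∈ P, T k j b ∈ Q) ∧ 2 * Module.finrank K Q ≤ Module.finrank K P ∧
        Fintype.card J ≤ Module.finrank K P := by
    intro m
    induction m with
    | zero =>
      rintro k rfl
      -- The line through c is mapped to zero, so its preimage already has dimension at least |J|.
      have h := card_mul_finrank_le_finrank_comap_add (T k) (T (k + 1)) (hex k le_rfl)
        (Submodule.span K {c}) ⊥ (fun j b hb => by
          obtain ⟨a, rfl⟩ := Submodule.mem_span_singleton.1 hb
          simp [hc])
      rw [finrank_span_singleton hne, finrank_bot] at h
      refine ⟨(Submodule.pi Set.univ fun _ : J => Submodule.span K {c}).comap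
        (LinearMap.pi (T k)), Submodule.span K {c}, fun j b hb => hb j (Set.mem_univ j), ?_, ?_⟩
      · rw [finrank_span_singleton hne]; omega
      · omega
    | succ m ih =>
      intro k hk
      obtain ⟨P, Q, hPQ, h₁, h₂⟩ := ih (k + 1) (by omega)
      have h := card_mul_finrank_le_finrank_comap_add (T k) (T (k + 1)) (hex k (by omega)) P Q hPQ
      refine ⟨(Submodule.pi Set.univ fun _ : J => P).comap (LinearMap.pi (T k)), P,
        fun j b hb => hb j (Set.mem_univ j), ?_, ?_⟩
      · nlinarith
      · nlinarith
  obtain ⟨P, Q, -, -, h⟩ := key n 0 (by omega)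
  exact absurd (h.trans P.finrank_le) (by omega)

end LinearAlgebra

/-! ### Exact sequences of modules are exact on stalks -/

section Exactness

variable {X : Scheme.{0}}

/-- The underlying sheaf of abelian groups of an `𝒪_X`-module. -/
def toAbSheaf (X : Scheme.{0}) : X.Modules ⥤ TopCat.Sheaf Ab.{0} X :=
  SheafOfModules.toSheaf X.ringCatSheaf

instance : (toAbSheaf X).Additive := inferInstanceAs (SheafOfModules.toSheaf _).Additive

instance : PreservesFiniteLimits (toAbSheaf X) :=
  inferInstanceAs (PreservesFiniteLimits (SheafOfModules.toSheaf X.ringCatSheaf))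

/-- Factor the underlying map of presheaves through its image and sheafify. The image inclusion
becomes monic and epic, hence invertible. So, up to isomorphisms, `p` is the sheafification of an
epimorphism of presheaves, and sheafification of abelian presheaves, a left adjoint, preserves
epimorphisms. -/
lemma epi_toSheaf_map {M N : SheafOfModules.{0} X.ringCatSheaf} (p : M ⟶ N) [Epi p] :
    Epi ((SheafOfModules.toSheaf X.ringCatSheaf).map p) := by
  let R := X.ringCatSheaf
  let L := PresheafOfModules.sheafification (𝟙 R.obj)
  let adj : L ⊣ _ := PresheafOfModules.sheafificationAdjunction (𝟙 R.obj)
  let G := SheafOfModules.forget R ⋙ PresheafOfModules.restrictScalars (𝟙 R.obj)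
  let e := Abelian.factorThruImage (G.map p)
  let m := Abelian.image.ι (G.map p)
  have hem : e ≫ m = G.map p := Abelian.image.fac _
  have hLp : L.map e ≫ L.map m = L.map (G.map p) := by rw [← L.map_comp, hem]
  have h1 : L.map (G.map p) ≫ adj.counit.app N = adj.counit.app M ≫ p := adj.counit.naturality p
  have : IsIso adj.counit :=
    inferInstanceAs (IsIso (PresheafOfModules.sheafificationAdjunction (𝟙 R.obj)).counit)
  have h2 : L.map (G.map p) = adj.counit.app M ≫ p ≫ inv (adj.counit.app N) := by
    rw [← Category.assoc, ← h1, Category.assoc, IsIso.hom_inv_id, Category.comp_id]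
  have : Epi (L.map (G.map p)) := by rw [h2]; infer_instance
  have : Epi (L.map m) := epi_of_epi_fac hLp
  have : Mono (L.map m) := inferInstance
  have : IsIso (L.map m) := isIso_of_mono_of_epi _
  have h3 : p = inv (adj.counit.app M) ≫ L.map e ≫ L.map m ≫ adj.counit.app N := by
    rw [← Category.assoc (L.map e), hLp, h1]; simp
  have : Epi ((SheafOfModules.toSheaf R).map (L.map e)) := by
    have h4 : Epi ((PresheafOfModules.toPresheaf R.obj).map e) := inferInstance
    have : (presheafToSheaf (Opens.grothendieckTopology X) AddCommGrpCat.{0}).IsLeftAdjoint :=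
      (sheafificationAdjunction _ _).isLeftAdjoint
    exact Functor.map_epi (presheafToSheaf (Opens.grothendieckTopology X) AddCommGrpCat.{0})
      ((PresheafOfModules.toPresheaf R.obj).map e)
  rw [h3, Functor.map_comp, Functor.map_comp]
  infer_instance

lemma shortExact_map_toAbSheaf {S : ShortComplex X.Modules} (hS : S.ShortExact) :
    (S.map (toAbSheaf X)).ShortExact := by
  have tfae := (toAbSheaf X).preservesFiniteLimits_tfae
  have h := tfae.out 3 0
  have h := h.1 inferInstance S hS
  have := hS.epi_g
  exact { exact := h.1, mono_f := h.2, epi_g :=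
    have : Epi (C := SheafOfModules X.ringCatSheaf) S.g := hS.epi_g
    epi_toSheaf_map (M := S.X₂) (N := S.X₃) S.g }

/-- Exact sequences of `𝒪_X`-modules are exact on stalks. -/
lemma exact_stalk {S : ShortComplex X.Modules} (hS : S.Exact) (x : X) :
    Function.Exact ((TopCat.Presheaf.stalkFunctor Ab x).map S.f.mapPresheaf)
      ((TopCat.Presheaf.stalkFunctor Ab x).map S.g.mapPresheaf) := by
  have tfae := (toAbSheaf X).exact_tfae
  have h := tfae.out 0 1
  have h := h.1 (fun S hS => shortExact_map_toAbSheaf hS) S hS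
  have h2 := (TopCat.Sheaf.exact_iff_stalkFunctor_map_exact _).1 h x
  rw [ShortComplex.ab_exact_iff_function_exact] at h2
  exact h2

lemma surjective_stalk {M N : X.Modules} (p : M ⟶ N) [Epi p] (x : X) :
    Function.Surjective ((TopCat.Presheaf.stalkFunctor Ab x).map p.mapPresheaf) := by
  have : (ShortComplex.mk p (0 : N ⟶ N) comp_zero).Exact := by
    rw [ShortComplex.exact_iff_epi _ rfl]
    infer_instance
  have h := exact_stalk this x
  intro y
  refine (h y).1 ?_
  change (TopCat.Presheaf.stalkFunctor Ab x).map (0 : N.presheaf ⟶ N.presheaf) y = 0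
  rw [Functor.map_zero]
  rfl

end Exactness

/-! ### Stalks as modules over the local rings -/

section Stalk

variable {X : Scheme.{0}}

/-- The stalk of an `𝒪_X`-module at a point. -/
abbrev stalk (M : X.Modules) (x : X) : Type := M.presheaf.stalk x

instance (M : X.Modules) (x : X) : Module (X.presheaf.stalk x) (stalk M x) :=
  PresheafOfModules.instModuleCarrierStalkCommRingCatCarrierAbPresheafOpensCarrier
    (R := X.presheaf) M.val x

/-- The germ at `x` of a section. -/
abbrev germ {M : X.Modules} {U : X.Opens} (s : Γ(M, U)) (x : X) (hx : x ∈ U) : stalk M x :=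
  M.presheaf.germ U x hx s

lemma germ_smul {M : X.Modules} {U : X.Opens} (g : Γ(X, U)) (s : Γ(M, U)) (x : X) (hx : x ∈ U) :
    germ (g • s) x hx = X.presheaf.germ U x hx g • germ s x hx :=
  PresheafOfModules.germ_smul (R := X.presheaf) M.val x U hx g s

lemma germ_res {M : X.Modules} {U V : X.Opens} (h : V ≤ U) (s : Γ(M, U)) (x : X) (hx : x ∈ V) :
    germ (res h s) x hx = germ s x (h hx) :=
  M.presheaf.germ_res_apply (homOfLE h) x hx s

lemma germ_resFun {U V : X.Opens} (h : V ≤ U) (g : Γ(X, U)) (x : X) (hx : x ∈ V) :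
    X.presheaf.germ V x hx (resFun h g) = X.presheaf.germ U x (h hx) g :=
  X.presheaf.germ_res_apply (homOfLE h) x hx g

lemma res_smul {M : X.Modules} {U V : X.Opens} (h : V ≤ U) (g : Γ(X, U)) (s : Γ(M, U)) :
    res h (g • s) = resFun h g • res h s :=
  Scheme.Modules.map_smul M (homOfLE h) g s

lemma res_res {M : X.Modules} {U V W : X.Opens} (h : V ≤ U) (h' : W ≤ V) (s : Γ(M, U)) :
    res h' (res h s) = res (h'.trans h) s := by
  change (M.presheaf.map (homOfLE h).op ≫ M.presheaf.map (homOfLE h').op) s = _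
  rw [← Functor.map_comp]
  rfl

lemma app_res {M N : X.Modules} (φ : M ⟶ N) {U V : X.Opens} (h : V ≤ U) (s : Γ(M, U)) :
    φ.app V (res h s) = res h (φ.app U s) :=
  congr($(φ.mapPresheaf.naturality (homOfLE h).op) s)

lemma exists_germ_smul (M : X.Modules) (x : X) (r : X.presheaf.stalk x) (m : stalk M x) :
    ∃ (U : X.Opens) (hx : x ∈ U) (g : Γ(X, U)) (s : Γ(M, U)),
      X.presheaf.germ U x hx g = r ∧ germ s x hx = m := by
  obtain ⟨U, hU, r, rfl⟩ := X.presheaf.exists_germ_eq r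
  obtain ⟨V, hV, m, rfl⟩ := M.presheaf.exists_germ_eq m
  exact ⟨U ⊓ V, ⟨hU, hV⟩, resFun inf_le_left r, res inf_le_right m,
    germ_resFun _ _ _ _, germ_res _ _ _ _⟩

/-- The map induced by a morphism on stalks. -/
def stalkMap {M N : X.Modules} (φ : M ⟶ N) (x : X) :
    stalk M x →ₗ[X.presheaf.stalk x] stalk N x where
  toFun := (TopCat.Presheaf.stalkFunctor Ab x).map φ.mapPresheaf
  map_add' := map_add _
  map_smul' r m := by
    obtain ⟨U, hx, g, s, rfl, rfl⟩ := exists_germ_smul M x r m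
    have key (s : Γ(M, U)) : (TopCat.Presheaf.stalkFunctor Ab x).map φ.mapPresheaf
        (germ s x hx) = germ (φ.app U s) x hx :=
      TopCat.Presheaf.stalkFunctor_map_germ_apply U x hx φ.mapPresheaf s
    rw [← germ_smul, key, key, Scheme.Modules.Hom.app_smul, germ_smul]
    rfl

lemma stalkMap_germ {M N : X.Modules} (φ : M ⟶ N) {U : X.Opens} (s : Γ(M, U)) (x : X)
    (hx : x ∈ U) : stalkMap φ x (germ s x hx) = germ (φ.app U s) x hx :=
  TopCat.Presheaf.stalkFunctor_map_germ_apply U x hx φ.mapPresheaf s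

lemma stalk_hom_ext {M : X.Modules} {x : X} {B : Type*} [AddCommGroup B]
    [Module (X.presheaf.stalk x) B] {f g : stalk M x →ₗ[X.presheaf.stalk x] B}
    (h : ∀ (U : X.Opens) (hx : x ∈ U) (s : Γ(M, U)), f (germ s x hx) = g (germ s x hx)) :
    f = g := by
  ext m
  obtain ⟨U, hx, s, rfl⟩ := M.presheaf.exists_germ_eq m
  exact h U hx s

lemma stalkMap_id (M : X.Modules) (x : X) : stalkMap (𝟙 M) x = LinearMap.id :=
  stalk_hom_ext fun U hx s => by rw [stalkMap_germ]; rfl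

lemma stalkMap_comp {M N K : X.Modules} (φ : M ⟶ N) (ψ : N ⟶ K) (x : X) :
    stalkMap (φ ≫ ψ) x = stalkMap ψ x ∘ₗ stalkMap φ x :=
  stalk_hom_ext fun U hx s => by
    rw [LinearMap.comp_apply, stalkMap_germ, stalkMap_germ, stalkMap_germ]; rfl

lemma stalkMap_add {M N : X.Modules} (φ ψ : M ⟶ N) (x : X) :
    stalkMap (φ + ψ) x = stalkMap φ x + stalkMap ψ x :=
  stalk_hom_ext fun U hx s => by
    rw [LinearMap.add_apply, stalkMap_germ, stalkMap_germ, stalkMap_germ, Scheme.Modules.Hom.add_app]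
    exact map_add (N.presheaf.germ U x hx).hom (φ.app U s) (ψ.app U s)

lemma stalkMap_zero (M K : X.Modules) (x : X) :
    stalkMap (0 : M ⟶ K) x = 0 := by
  have := stalkMap_add (0 : M ⟶ K) 0 x
  rwa [add_zero, left_eq_add] at this

lemma stalkMap_globalMul (r : Γ(X, ⊤)) (M : X.Modules) (x : X) :
    stalkMap (globalMul r M) x = X.presheaf.germ ⊤ x trivial r • LinearMap.id :=
  stalk_hom_ext fun U hx s => by
    rw [stalkMap_germ, globalMul_app, germ_smul]
    congr 1
    exact germ_resFun le_top r x hx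

end Stalk

/-! ### Fibres over the residue fields and their right exactness -/

section Fibre

variable {X : Scheme.{0}}

/-- The residue field at a point. -/
abbrev resField (x : X) : Type := IsLocalRing.ResidueField (X.presheaf.stalk x)

/-- The fibre of an `𝒪_X`-module at a point. -/
abbrev fib (M : X.Modules) (x : X) : Type := resField x ⊗[X.presheaf.stalk x] stalk M x

/-- The map induced by a morphism on fibres, as an additive map on morphisms. -/
def fibMap (M N : X.Modules) (x : X) : (M ⟶ N) →+ (fib M x →ₗ[resField x] fib N x) where
  toFun φ := (stalkMap φ x).baseChange (resField x)
  map_zero' := by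
    rw [stalkMap_zero, LinearMap.baseChange_zero]
  map_add' φ ψ := by rw [stalkMap_add, LinearMap.baseChange_add]

lemma fibMap_tmul {M N : X.Modules} {x : X} (φ : M ⟶ N) (a : resField x) (m : stalk M x) :
    fibMap M N x φ (a ⊗ₜ m) = a ⊗ₜ stalkMap φ x m := rfl

lemma fibMap_id (M : X.Modules) (x : X) : fibMap M M x (𝟙 M) = LinearMap.id := by
  change (stalkMap (𝟙 M) x).baseChange _ = _
  rw [stalkMap_id, LinearMap.baseChange_id]

lemma fibMap_comp {M N K : X.Modules} (φ : M ⟶ N) (ψ : N ⟶ K) (x : X) :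
    fibMap M K x (φ ≫ ψ) = fibMap N K x ψ ∘ₗ fibMap M N x φ := by
  change (stalkMap (φ ≫ ψ) x).baseChange _ = _
  rw [stalkMap_comp, LinearMap.baseChange_comp]
  rfl

lemma fibMap_comp_apply {M N K : X.Modules} (φ : M ⟶ N) (ψ : N ⟶ K) (x : X) (v : fib M x) :
    fibMap M K x (φ ≫ ψ) v = fibMap N K x ψ (fibMap M N x φ v) :=
  congr($(fibMap_comp φ ψ x) v)

lemma fibMap_globalMul (r : Γ(X, ⊤)) (M : X.Modules) (x : X) :
    fibMap M M x (globalMul r M) =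
      IsLocalRing.residue _ (X.presheaf.germ ⊤ x trivial r) • LinearMap.id := by
  change (stalkMap _ x).baseChange _ = _
  rw [stalkMap_globalMul, LinearMap.baseChange_smul, LinearMap.baseChange_id]
  ext
  rfl

lemma exact_stalkMap {S : ShortComplex X.Modules} (hS : S.Exact) (x : X) :
    Function.Exact (stalkMap S.f x) (stalkMap S.g x) := exact_stalk hS x

lemma surjective_stalkMap {M N : X.Modules} (p : M ⟶ N) [Epi p] (x : X) :
    Function.Surjective (stalkMap p x) := surjective_stalk p x

lemma surjective_fibMap {M N : X.Modules} (p : M ⟶ N) [Epi p] (x : X) :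
    Function.Surjective (fibMap M N x p) :=
  LinearMap.lTensor_surjective _ (surjective_stalkMap p x)

lemma exact_fibMap {S : ShortComplex X.Modules} (hS : S.Exact) [Epi S.g] (x : X) :
    Function.Exact (fibMap _ _ x S.f) (fibMap _ _ x S.g) :=
  lTensor_exact _ (exact_stalkMap hS x) (surjective_stalkMap S.g x)

end Fibre

/-! ### Local frames, tested on stalks and on fibres -/

section Frames

/-- The family `v` is a basis of `M`. -/
def IsBasis (R : Type*) {ι M : Type*} [Ring R] [AddCommGroup M] [Module R M] (v : ι → M) : Prop :=
  LinearIndependent R v ∧ Submodule.span R (Set.range v) = ⊤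

/-- The basis with underlying family `v`. -/
def IsBasis.basis {R ι M : Type*} [Ring R] [AddCommGroup M] [Module R M] {v : ι → M}
    (h : IsBasis R v) : Module.Basis ι R M := .mk h.1 h.2.ge

lemma IsBasis.basis_apply {R ι M : Type*} [Ring R] [AddCommGroup M] [Module R M] {v : ι → M}
    (h : IsBasis R v) (i : ι) : h.basis i = v i := Module.Basis.mk_apply _ _ _

lemma IsBasis.repr_sum_smul {R ι M : Type*} [Ring R] [AddCommGroup M] [Module R M] {v : ι → M}
    [Fintype ι] (h : IsBasis R v) (c : ι → R) (i : ι) :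
    h.basis.repr (∑ j, c j • v j) i = c i := by
  simp only [← h.basis_apply]
  exact congrFun (h.basis.repr_sum_self c) i

lemma isBasis_basis {R ι M : Type*} [Ring R] [AddCommGroup M] [Module R M]
    (b : Module.Basis ι R M) : IsBasis R b := ⟨b.linearIndependent, b.span_eq⟩

lemma IsBasis.comp_equiv {R ι κ M : Type*} [Ring R] [AddCommGroup M] [Module R M] {v : ι → M}
    (h : IsBasis R v) (e : κ ≃ ι) : IsBasis R (v ∘ e) :=
  ⟨h.1.comp _ e.injective, by rw [e.surjective.range_comp, h.2]⟩

variable {X : Scheme.{0}}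

/-- The germs of the sections `s` form a basis of the stalk at every point. -/
def IsStalkFrame {M : X.Modules} {U : X.Opens} {ι : Type} (s : ι → Γ(M, U)) : Prop :=
  ∀ (x : X) (hx : x ∈ U), IsBasis (X.presheaf.stalk x) fun j => germ (s j) x hx

lemma exists_germ_family {ι : Type} [Fintype ι] {U : X.Opens} {x : X} (hx : x ∈ U)
    (r : ι → X.presheaf.stalk x) : ∃ (V : X.Opens) (_ : V ≤ U) (hV : x ∈ V) (g : ι → Γ(X, V)),
      ∀ j, X.presheaf.germ V x hV (g j) = r j := by
  choose W hW g hg using fun j => X.presheaf.exists_germ_eq (r j)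
  have hxV : x ∈ U ⊓ Finset.univ.inf W := by
    refine ⟨hx, ?_⟩
    change x ∈ ((Finset.univ.inf W : X.Opens) : Set X)
    rw [Opens.coe_finset_inf]
    simpa using hW
  refine ⟨U ⊓ Finset.univ.inf W, inf_le_left, hxV, fun j => resFun (inf_le_right.trans
    (Finset.inf_le (Finset.mem_univ j))) (g j), fun j => ?_⟩
  rw [germ_resFun, hg]

lemma res_sum_smul {M : X.Modules} {U V : X.Opens} (h : V ≤ U) {ι : Type} [Fintype ι]
    (g : ι → Γ(X, U)) (s : ι → Γ(M, U)) :
    res h (∑ j, g j • s j) = ∑ j, resFun h (g j) • res h (s j) := by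
  rw [res, map_sum]
  exact Finset.sum_congr rfl fun j _ => res_smul h _ _

lemma germ_sum_smul {M : X.Modules} {U : X.Opens} {ι : Type} [Fintype ι]
    (g : ι → Γ(X, U)) (s : ι → Γ(M, U)) (x : X) (hx : x ∈ U) :
    germ (∑ j, g j • s j) x hx = ∑ j, X.presheaf.germ U x hx (g j) • germ (s j) x hx := by
  rw [germ, map_sum]
  exact Finset.sum_congr rfl fun j _ => germ_smul _ _ _ _

lemma exists_res_eq_of_germ_eq {M : X.Modules} {U : X.Opens} {s t : Γ(M, U)} {x : X} {hx : x ∈ U}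
    (h : germ s x hx = germ t x hx) : ∃ (V : X.Opens) (hV : V ≤ U), x ∈ V ∧ res hV s = res hV t := by
  obtain ⟨W, hW, i, j, hij⟩ := M.presheaf.germ_eq x hx hx s t h
  exact ⟨W, i.le, hW, hij⟩

lemma section_ext {M : X.Modules} {U : X.Opens} {s t : Γ(M, U)}
    (h : ∀ x hx, germ s x hx = germ t x hx) : s = t :=
  TopCat.Presheaf.section_ext ⟨M.presheaf, M.isSheaf⟩ U s t h

lemma function_ext {U : X.Opens} {f g : Γ(X, U)}
    (h : ∀ x hx, X.presheaf.germ U x hx f = X.presheaf.germ U x hx g) : f = g :=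
  TopCat.Presheaf.section_ext X.sheaf U f g h

/-- A linear relation between germs, or an expression of a germ in the frame, involves finitely many
functions and so lives on a small neighbourhood, where the frame property applies. -/
lemma IsFrame.isStalkFrame {M : X.Modules} {U : X.Opens} {r : ℕ} {s : Fin r → Γ(M, U)}
    (hs : IsFrame s) : IsStalkFrame s := by
  intro x hx
  constructor
  · rw [Fintype.linearIndependent_iff]
    intro c hc
    obtain ⟨V, hVU, hV, g, hg⟩ := exists_germ_family hx c
    have h0 : germ (∑ j, g j • res hVU (s j)) x hV = germ (0 : Γ(M, V)) x hV := by
      rw [germ_sum_smul]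
      simp only [germ_res, hg, hc]
      exact (map_zero (M.presheaf.germ V x hV).hom).symm
    obtain ⟨W, hWV, hW, h1⟩ := exists_res_eq_of_germ_eq h0
    rw [res_sum_smul] at h1
    simp only [res_res] at h1
    have h2 := Fintype.linearIndependent_iff.1 (hs W (hWV.trans hVU)).1 _
      (h1.trans (map_zero (M.presheaf.map (homOfLE hWV).op).hom))
    intro j
    rw [← hg j, ← germ_resFun hWV (g j) x hW, h2 j, map_zero]
  · rw [eq_top_iff]
    rintro m -
    obtain ⟨V, hV, m, rfl⟩ := M.presheaf.exists_germ_eq m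
    have hxx : x ∈ U ⊓ V := ⟨hx, hV⟩
    have h1 : res inf_le_right m ∈ Submodule.span Γ(X, U ⊓ V) (Set.range fun j =>
        res (inf_le_left : U ⊓ V ≤ U) (s j)) := by
      rw [(hs (U ⊓ V) inf_le_left).2]; trivial
    obtain ⟨g, hg⟩ := (Submodule.mem_span_range_iff_exists_fun _).1 h1
    refine (Submodule.mem_span_range_iff_exists_fun _).2 ⟨fun j =>
      X.presheaf.germ (U ⊓ V) x hxx (g j), ?_⟩
    have h2 := congr(germ $hg x hxx)
    rw [germ_sum_smul, germ_res] at h2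
    simpa only [germ_res] using h2

lemma IsStalkFrame.res {M : X.Modules} {U V : X.Opens} {ι : Type} {s : ι → Γ(M, U)}
    (hs : IsStalkFrame s) (h : V ≤ U) : IsStalkFrame fun j => res h (s j) := by
  intro x hx
  simpa only [germ_res] using hs x (h hx)

lemma IsStalkFrame.eq_of_sum_smul_eq {M : X.Modules} {U : X.Opens} {ι : Type} [Fintype ι]
    {s : ι → Γ(M, U)} (hs : IsStalkFrame s) {f g : ι → Γ(X, U)}
    (h : ∑ j, f j • s j = ∑ j, g j • s j) (j : ι) : f j = g j := by
  refine function_ext fun x hx => ?_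
  have h1 := congr(germ $h x hx)
  rw [germ_sum_smul, germ_sum_smul] at h1
  exact congrFun ((Fintype.linearIndependent_iffₛ.1 (hs x hx).1) _ _ h1 |> funext) j

/-- The coefficients exist near each point because the germs span. They are unique by
`IsStalkFrame.eq_of_sum_smul_eq`, so they agree on overlaps and glue. -/
lemma IsStalkFrame.exists_eq_sum_smul {M : X.Modules} {U : X.Opens} {ι : Type} [Fintype ι]
    {s : ι → Γ(M, U)} (hs : IsStalkFrame s) (t : Γ(M, U)) :
    ∃ g : ι → Γ(X, U), ∑ j, g j • s j = t := by
  have loc : ∀ x : U, ∃ (V : X.Opens) (hVU : V ≤ U) (_ : x.1 ∈ V) (g : ι → Γ(X, V)),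
      ∑ j, g j • FibonacciBundle.res hVU (s j) = FibonacciBundle.res hVU t := by
    rintro ⟨x, hx⟩
    have h1 : germ t x hx ∈ Submodule.span (X.presheaf.stalk x) (Set.range fun j =>
        germ (s j) x hx) := by
      rw [(hs x hx).2]; trivial
    obtain ⟨c, hc⟩ := (Submodule.mem_span_range_iff_exists_fun _).1 h1
    obtain ⟨V, hVU, hV, g, hg⟩ := exists_germ_family hx c
    have h2 : germ (∑ j, g j • FibonacciBundle.res hVU (s j)) x hV =
        germ (FibonacciBundle.res hVU t) x hV := by
      rw [germ_sum_smul, germ_res]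
      simp only [germ_res, hg, hc]
    obtain ⟨W, hWV, hW, h3⟩ := exists_res_eq_of_germ_eq h2
    rw [res_sum_smul] at h3
    simp only [res_res] at h3
    exact ⟨W, hWV.trans hVU, hW, _, h3⟩
  choose V hVU hV g hg using loc
  have glue : ∀ j, ∃ f : Γ(X, U), ∀ x, resFun (hVU x) f = g x j := by
    intro j
    obtain ⟨f, hf, -⟩ := X.sheaf.existsUnique_gluing' V U (fun x => homOfLE (hVU x))
      (fun x hx => Opens.mem_iSup.2 ⟨⟨x, hx⟩, hV ⟨x, hx⟩⟩) (fun x => g x j) (by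
        intro x y
        refine IsStalkFrame.eq_of_sum_smul_eq (hs.res (inf_le_left.trans (hVU x)))
          (f := fun j => resFun inf_le_left (g x j)) (g := fun j => resFun inf_le_right (g y j))
          ?_ j
        have hx := congr(FibonacciBundle.res (inf_le_left : V x ⊓ V y ≤ _) $(hg x))
        have hy := congr(FibonacciBundle.res (inf_le_right : V x ⊓ V y ≤ _) $(hg y))
        rw [res_sum_smul] at hx hy
        simp only [res_res] at hx hy
        rw [hx, hy])
    exact ⟨f, hf⟩
  choose f hf using glue
  refine ⟨f, section_ext fun x hx => ?_⟩
  rw [← germ_res (hVU ⟨x, hx⟩) t x (hV ⟨x, hx⟩), ← hg,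
    ← germ_res (hVU ⟨x, hx⟩) _ x (hV ⟨x, hx⟩), res_sum_smul]
  simp only [hf]

lemma IsStalkFrame.isFrame {M : X.Modules} {U : X.Opens} {r : ℕ} {s : Fin r → Γ(M, U)}
    (hs : IsStalkFrame s) : IsFrame s := by
  intro V h
  constructor
  · rw [Fintype.linearIndependent_iffₛ]
    exact fun f g hfg j => (hs.res h).eq_of_sum_smul_eq hfg j
  · rw [eq_top_iff]
    rintro t -
    exact (Submodule.mem_span_range_iff_exists_fun _).2 ((hs.res h).exists_eq_sum_smul t)

lemma isVectorBundle_of_isStalkFrame {M : X.Modules}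
    (h : ∀ x : X, ∃ (U : X.Opens) (_ : x ∈ U) (ι : Type) (_ : Fintype ι) (s : ι → Γ(M, U)),
      IsStalkFrame s) : IsVectorBundle M := by
  intro x
  obtain ⟨U, hx, ι, _, s, hs⟩ := h x
  exact ⟨U, hx, Fintype.card ι, s ∘ (Fintype.equivFin ι).symm,
    IsStalkFrame.isFrame fun y hy => (hs y hy).comp_equiv (Fintype.equivFin ι).symm⟩

/-- The value of a section in the fibre. -/
def value {M : X.Modules} {U : X.Opens} (s : Γ(M, U)) (x : X) (hx : x ∈ U) : fib M x :=
  1 ⊗ₜ germ s x hx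

lemma fibMap_value {M N : X.Modules} (φ : M ⟶ N) {U : X.Opens} (s : Γ(M, U)) (x : X)
    (hx : x ∈ U) : fibMap M N x φ (value s x hx) = value (φ.app U s) x hx := by
  rw [value, fibMap_tmul, stalkMap_germ]; rfl

lemma isBasis_value {M : X.Modules} {U : X.Opens} {ι : Type} {s : ι → Γ(M, U)}
    (hs : IsStalkFrame s) (x : X) (hx : x ∈ U) :
    IsBasis (resField x) fun j => value (s j) x hx := by
  have := isBasis_basis ((hs x hx).basis.baseChange (resField x))
  convert this using 1
  ext j
  rw [Module.Basis.baseChange_apply, IsBasis.basis_apply]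
  rfl

lemma value_smul {M : X.Modules} {U : X.Opens} (g : Γ(X, U)) (s : Γ(M, U)) (x : X) (hx : x ∈ U) :
    value (g • s) x hx =
      IsLocalRing.residue _ (X.presheaf.germ U x hx g) • value s x hx := by
  rw [value, germ_smul, ← TensorProduct.smul_tmul, value, TensorProduct.smul_tmul']
  rfl

lemma value_sum_smul {M : X.Modules} {U : X.Opens} {ι : Type} [Fintype ι]
    (g : ι → Γ(X, U)) (s : ι → Γ(M, U)) (x : X) (hx : x ∈ U) :
    value (∑ j, g j • s j) x hx =
      ∑ j, IsLocalRing.residue _ (X.presheaf.germ U x hx (g j)) • value (s j) x hx := by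
  simp only [← value_smul]
  simp only [value, germ, map_sum, TensorProduct.tmul_sum]

lemma value_res {M : X.Modules} {U V : X.Opens} (h : V ≤ U) (s : Γ(M, U)) (x : X) (hx : x ∈ V) :
    value (res h s) x hx = value s x (h hx) := by
  rw [value, germ_res]; rfl

lemma value_eq_zero_of_vanishesAt {M : X.Modules} {U : X.Opens} {s : Γ(M, U)} {x : X}
    (hx : x ∈ U) (h : VanishesAt s x) : value s x hx = 0 := by
  obtain ⟨V, hVU, hV, m, g, t, hg, hs⟩ := h
  rw [← value_res hVU s x hV, hs, value_sum_smul]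
  refine Finset.sum_eq_zero fun j _ => ?_
  have h1 := hg j
  rw [Scheme.mem_basicOpen X _ x hV, ← IsLocalRing.residue_ne_zero_iff_isUnit, not_not] at h1
  rw [h1, zero_smul]

/-- In a local frame the values of the frame are independent in the fibre, so the coordinate
functions of a section of value zero all vanish at the point. -/
lemma IsVectorBundle.vanishesAt {M : X.Modules} (hM : IsVectorBundle M) {U : X.Opens}
    {s : Γ(M, U)} {x : X} (hx : x ∈ U) (h : value s x hx = 0) : VanishesAt s x := by
  obtain ⟨V, hV, r, t, ht⟩ := hM x
  have hxx : x ∈ U ⊓ V := ⟨hx, hV⟩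
  have ht' := ht.isStalkFrame.res (inf_le_right : U ⊓ V ≤ V)
  obtain ⟨g, hg⟩ := ht'.exists_eq_sum_smul (res inf_le_left s)
  refine ⟨U ⊓ V, inf_le_left, ⟨hx, hV⟩, r, g, _, fun j => ?_, hg.symm⟩
  rw [Scheme.mem_basicOpen X _ x hxx, ← IsLocalRing.residue_ne_zero_iff_isUnit, not_not]
  have h1 := congr(value $hg x hxx)
  rw [value_res, h, value_sum_smul] at h1
  exact Fintype.linearIndependent_iff.1 (isBasis_value ht' x hxx).1 _ h1 j

lemma isInjectiveBundleMap_of_injective {M N : X.Modules} (hM : IsVectorBundle M) {φ : M ⟶ N}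
    (h : ∀ x, Function.Injective (fibMap M N x φ)) : IsInjectiveBundleMap φ := by
  intro x U hx s hs
  refine hM.vanishesAt hx (h x ?_)
  rw [fibMap_value, value_eq_zero_of_vanishesAt hx hs, map_zero]

lemma finite_fib {M : X.Modules} (hM : IsVectorBundle M) (x : X) :
    Module.Finite (resField x) (fib M x) := by
  obtain ⟨V, hV, r, t, ht⟩ := hM x
  exact Module.Finite.of_basis (isBasis_value ht.isStalkFrame x hV).basis

/-- Sections that are a basis of the fibre at a point form a frame near that point. -/
lemma exists_isStalkFrame_of_isBasis_value {M : X.Modules} (hM : IsVectorBundle M) {U : X.Opens}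
    {x : X} (hx : x ∈ U) {ι : Type} [Fintype ι] (u : ι → Γ(M, U))
    (hu : IsBasis (resField x) fun k => value (u k) x hx) :
    ∃ (V : X.Opens) (h : V ≤ U), x ∈ V ∧ IsStalkFrame fun k => res h (u k) := by
  classical
  obtain ⟨U', hx', r, t', ht'⟩ := hM x
  have hxx : x ∈ U ⊓ U' := ⟨hx, hx'⟩
  have ht'' := ht'.isStalkFrame.res (inf_le_right : U ⊓ U' ≤ U')
  let e : ι ≃ Fin r := hu.basis.indexEquiv (isBasis_value ht'' x hxx).basis
  let t : ι → Γ(M, U ⊓ U') := fun i => res inf_le_right (t' (e i))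
  have ht : IsStalkFrame t := fun y hy => (ht'' y hy).comp_equiv e
  choose a ha using fun k => ht.exists_eq_sum_smul (res inf_le_left (u k))
  -- The change-of-frame determinant is nonzero at x, hence a unit on its basic open set, and there
  -- the sections are again a frame.
  let A : Matrix ι ι Γ(X, U ⊓ U') := Matrix.of fun i k => a k i
  have hdet (y : X) (hy : y ∈ U ⊓ U') : (ht y hy).basis.det (fun k => germ (u k) y hy.1) =
      X.presheaf.germ (U ⊓ U') y hy A.det := by
    rw [Module.Basis.det_apply, RingHom.map_det]
    congr 1
    ext i k
    rw [Module.Basis.toMatrix_apply, ← germ_res inf_le_left (u k) y hy, ← ha k, germ_sum_smul,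
      IsBasis.repr_sum_smul]
    rfl
  have hdetx : (isBasis_value ht x hxx).basis.det (fun k => value (u k) x hx) =
      IsLocalRing.residue _ (X.presheaf.germ (U ⊓ U') x hxx A.det) := by
    rw [Module.Basis.det_apply, RingHom.map_det, RingHom.map_det]
    congr 1
    ext i k
    rw [Module.Basis.toMatrix_apply, ← value_res inf_le_left (u k) x hxx, ← ha k,
      value_sum_smul, IsBasis.repr_sum_smul]
    rfl
  refine ⟨X.basicOpen A.det, (X.basicOpen_le _).trans inf_le_left, ?_, fun y hy => ?_⟩
  · rw [Scheme.mem_basicOpen X _ x hxx, ← IsLocalRing.residue_ne_zero_iff_isUnit, ← hdetx]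
    exact ((Module.Basis.is_basis_iff_det _).1 hu).ne_zero
  · have hy' := X.basicOpen_le _ hy
    simp only [germ_res]
    refine (Module.Basis.is_basis_iff_det (ht y hy').basis).2 ?_
    rw [hdet]
    exact (Scheme.mem_basicOpen X _ y hy').1 hy

end Frames

/-! ### Injective bundle maps: monomorphisms with locally free cokernel -/

section Cokernel

/-- Steinitz exchange: an independent family is completed by members of a given spanning family. The
disjoint union of index types keeps the two parts separate. -/
lemma exists_isBasis_sumElim {K V ι κ : Type*} [Field K] [AddCommGroup V] [Module K V]
    {f : ι → V} (hf : LinearIndependent K f) {t : κ → V}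
    (ht : Submodule.span K (Set.range t) = ⊤) :
    ∃ c : Set κ, IsBasis K (Sum.elim f fun i : c => t i) := by
  have h0 : LinearIndepOn K (Sum.elim f t) (Set.range Sum.inl) := by
    rw [linearIndepOn_range_iff Sum.inl_injective]
    exact hf
  obtain ⟨b, -, hb, hspan, hli⟩ := exists_linearIndepOn_extension h0 (Set.subset_univ _)
  let c : Set κ := Sum.inr ⁻¹' b
  let e : ι ⊕ c → b := Sum.elim (fun i => ⟨Sum.inl i, hb ⟨i, rfl⟩⟩) fun i => ⟨Sum.inr i, i.2⟩
  have he : Function.Injective e := by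
    rintro (i | i) (j | j) h <;> simp [e, Subtype.ext_iff] at h ⊢ <;> exact h
  have hcomp : (fun i : b => Sum.elim f t i) ∘ e = Sum.elim f fun i : c => t i := by
    ext (i | i) <;> rfl
  have hes : Function.Surjective e := by
    rintro ⟨i | i, hi⟩
    · exact ⟨Sum.inl i, rfl⟩
    · exact ⟨Sum.inr ⟨i, hi⟩, rfl⟩
  refine ⟨c, ?_, ?_⟩
  · rw [← hcomp]
    exact LinearIndependent.comp hli e he
  · rw [← hcomp, hes.range_comp, eq_top_iff, ← ht, Submodule.span_le]
    rintro _ ⟨i, rfl⟩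
    have := hspan ⟨Sum.inr i, trivial, rfl⟩
    rwa [Set.image_eq_range] at this

lemma isBasis_comp_inr_of_exact {R M N Q ι κ : Type*} [Ring R] [AddCommGroup M] [Module R M]
    [AddCommGroup N] [Module R N] [AddCommGroup Q] [Module R Q] {f : M →ₗ[R] N} {g : N →ₗ[R] Q}
    (hfg : Function.Exact f g) (hg : Function.Surjective g) {s : ι → M}
    (hs : Submodule.span R (Set.range s) = ⊤) {u : κ → N}
    (hu : IsBasis R (Sum.elim (f ∘ s) u)) : IsBasis R (g ∘ u) := by
  have hr : Submodule.span R (Set.range (f ∘ s)) = LinearMap.ker g := by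
    rw [Set.range_comp, ← Submodule.map_span, hs, Submodule.map_top]
    exact (LinearMap.exact_iff.1 hfg).symm
  constructor
  · have h := linearIndependent_sum.1 hu.1
    rw [Sum.elim_comp_inl, Sum.elim_comp_inr, hr] at h
    exact h.2.1.map h.2.2.symm
  · rw [eq_top_iff, ← LinearMap.range_eq_top.2 hg, LinearMap.range_eq_map, ← hu.2,
      Submodule.map_span, Submodule.span_le]
    rintro _ ⟨_, ⟨i | i, rfl⟩, rfl⟩
    · rw [Sum.elim_inl, Function.comp_apply, hfg.apply_apply_eq_zero]
      exact zero_mem _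
    · exact Submodule.subset_span ⟨i, rfl⟩

variable {X : Scheme.{0}}

/-- The local normal form of a map injective on a fibre. The images of a frame of `M` are
independent in the fibre at x. Complete them there by values of a frame of `N`; the resulting basis
of the fibre spreads out to a frame. -/
lemma exists_isStalkFrame_sumElim {M N : X.Modules} (hM : IsVectorBundle M)
    (hN : IsVectorBundle N) (φ : M ⟶ N) (x : X) (hφ : Function.Injective (fibMap M N x φ)) :
    ∃ (V : X.Opens) (_ : x ∈ V) (ι κ : Type) (_ : Fintype ι) (_ : Fintype κ)
      (s : ι → Γ(M, V)) (t : κ → Γ(N, V)), IsStalkFrame s ∧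
        IsStalkFrame (Sum.elim (fun i => φ.app V (s i)) t) := by
  classical
  obtain ⟨U, hU, r, s, hs⟩ := hM x
  obtain ⟨U', hU', n, t, ht⟩ := hN x
  have hx : x ∈ U ⊓ U' := ⟨hU, hU'⟩
  have hs' := hs.isStalkFrame.res (inf_le_left : U ⊓ U' ≤ U)
  have ht' := ht.isStalkFrame.res (inf_le_right : U ⊓ U' ≤ U')
  have hli := ((isBasis_value hs' x hx).1).map' _ (LinearMap.ker_eq_bot.2 hφ)
  obtain ⟨c, hc⟩ := exists_isBasis_sumElim hli (isBasis_value ht' x hx).2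
  have hc' : IsBasis (resField x) fun k : Fin r ⊕ c =>
      value (Sum.elim (fun i => φ.app _ (res inf_le_left (s i)))
        (fun i : c => res inf_le_right (t i)) k : Γ(N, U ⊓ U')) x hx := by
    convert hc using 1
    ext (i | i)
    · exact (fibMap_value _ _ _ _).symm
    · rfl
  obtain ⟨V, hVU, hV, hVf⟩ := exists_isStalkFrame_of_isBasis_value hN hx _ hc'
  refine ⟨V, hV, Fin r, c, inferInstance, inferInstance,
    fun i => res hVU (res inf_le_left (s i)), fun i => res hVU (res inf_le_right (t i)),
    hs'.res hVU, ?_⟩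
  convert hVf using 1
  ext (i | i)
  · exact app_res φ hVU _
  · rfl

/-- The cokernel of an injective bundle map is a vector bundle. -/
lemma isVectorBundle_of_exact {S : ShortComplex X.Modules} (hS : S.Exact) [Epi S.g]
    (h₁ : IsVectorBundle S.X₁) (h₂ : IsVectorBundle S.X₂)
    (hf : ∀ x, Function.Injective (fibMap _ _ x S.f)) : IsVectorBundle S.X₃ := by
  refine isVectorBundle_of_isStalkFrame fun x => ?_
  obtain ⟨V, hV, ι, κ, _, _, s, t, hs, ht⟩ := exists_isStalkFrame_sumElim h₁ h₂ S.f x (hf x)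
  refine ⟨V, hV, κ, inferInstance, fun i => S.g.app V (t i), fun y hy => ?_⟩
  have := isBasis_comp_inr_of_exact (exact_stalkMap hS y) (surjective_stalkMap S.g y)
    (hs y hy).2 (u := fun i => germ (t i) y hy) (by
      convert ht y hy using 1
      ext (i | i)
      · exact stalkMap_germ _ _ _ _
      · rfl)
  convert this using 1
  ext i
  exact (stalkMap_germ _ _ _ _).symm

lemma injective_stalkMap_of_injective_fibMap {M N : X.Modules} (hM : IsVectorBundle M)
    (hN : IsVectorBundle N) (φ : M ⟶ N) (x : X) (hφ : Function.Injective (fibMap M N x φ)) :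
    Function.Injective (stalkMap φ x) := by
  obtain ⟨V, hV, ι, κ, _, _, s, t, hs, ht⟩ := exists_isStalkFrame_sumElim hM hN φ x hφ
  have h1 := (linearIndependent_sum.1 (ht x hV).1).1
  refine LinearMap.ker_eq_bot.1 (LinearMap.ker_eq_bot'.2 fun m hm => ?_)
  rw [← (hs x hV).basis.sum_repr m] at hm ⊢
  rw [map_sum] at hm
  simp only [map_smul, IsBasis.basis_apply, stalkMap_germ] at hm
  exact Finset.sum_eq_zero fun i _ => by
    rw [Fintype.linearIndependent_iff.1 h1 _ hm i, zero_smul]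

lemma mono_of_injective_stalkMap {M N : X.Modules} (φ : M ⟶ N)
    (h : ∀ x, Function.Injective (stalkMap φ x)) : Mono φ := by
  refine Preadditive.mono_of_cancel_zero _ fun {K} g hg => ?_
  ext U s
  refine section_ext fun x hx => h x ?_
  rw [stalkMap_germ, stalkMap_germ]
  have h1 : φ.app U (g.app U s) = φ.app U ((0 : K ⟶ M).app U s) := by
    change (g ≫ φ).app U s = ((0 : K ⟶ M) ≫ φ).app U s
    rw [hg, zero_comp]
  rw [h1]

/-- An injective map of vector bundles is a monomorphism of sheaves. -/
lemma mono_of_injective_fibMap {M N : X.Modules} (hM : IsVectorBundle M)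
    (hN : IsVectorBundle N) (φ : M ⟶ N) (hφ : ∀ x, Function.Injective (fibMap M N x φ)) : Mono φ :=
  mono_of_injective_stalkMap φ fun x => injective_stalkMap_of_injective_fibMap hM hN φ x (hφ x)

/-- A bundle of rank zero has an empty frame near each point, so its stalks vanish. -/
lemma eq_zero_of_finrank_fib_eq_zero {M N : X.Modules} (hM : IsVectorBundle M)
    (h : ∀ x, Module.finrank (resField x) (fib M x) = 0) (f : N ⟶ M) : f = 0 := by
  ext U s
  refine section_ext fun x hx => ?_
  obtain ⟨V, hV, r, t, ht⟩ := hM x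
  have h1 := h x
  rw [Module.finrank_eq_card_basis (isBasis_value ht.isStalkFrame x hV).basis] at h1
  have : IsEmpty (Fin r) := Fintype.card_eq_zero_iff.1 h1
  have h2 := (ht.isStalkFrame x hV).2
  rw [Set.range_eq_empty, Submodule.span_empty] at h2
  have h3 : ∀ m : stalk M x, m = 0 := fun m => by
    have : m ∈ (⊤ : Submodule (X.presheaf.stalk x) (stalk M x)) := trivial
    rwa [← h2, Submodule.mem_bot] at this
  rw [h3 (germ (f.app U s) x hx), h3 (germ _ x hx)]

/-- The rank of a vector bundle is locally constant. -/
lemma exists_forall_finrank_fib_eq {M : X.Modules} (hM : IsVectorBundle M) (x : X) :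
    ∃ (U : X.Opens) (_ : x ∈ U), ∀ y ∈ U,
      Module.finrank (resField y) (fib M y) = Module.finrank (resField x) (fib M x) := by
  obtain ⟨U, hx, r, s, hs⟩ := hM x
  refine ⟨U, hx, fun y hy => ?_⟩
  rw [Module.finrank_eq_card_basis (isBasis_value hs.isStalkFrame x hx).basis,
    Module.finrank_eq_card_basis (isBasis_value hs.isStalkFrame y hy).basis]

end Cokernel

/-! ### The generic point of projective space and constancy of rank -/

section ProjectiveSpace

attribute [local instance] MvPolynomial.gradedAlgebra

/-- The zero ideal is a homogeneous prime, and it is a relevant one since the variable of index 0 is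
nonzero. Being the smallest prime, it specialises to every point. -/
lemma exists_forall_mem_isOpen (N : ℕ) :
    ∃ η : ProjectiveSpectrum (MvPolynomial.homogeneousSubmodule (Fin (N + 1)) ℂ),
      ∀ U : Set (ProjectiveSpectrum (MvPolynomial.homogeneousSubmodule (Fin (N + 1)) ℂ)),
        IsOpen U → ∀ x ∈ U, η ∈ U := by
  let 𝒜 := MvPolynomial.homogeneousSubmodule (Fin (N + 1)) ℂ
  let η : ProjectiveSpectrum 𝒜 :=
    { asHomogeneousIdeal := ⊥
      isPrime := by
        change (⊥ : Ideal (MvPolynomial (Fin (N + 1)) ℂ)).IsPrime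
        exact Ideal.isPrime_bot
      not_irrelevant_le := by
        intro h
        have h1 : (MvPolynomial.X 0 : MvPolynomial (Fin (N + 1)) ℂ) ∈
            HomogeneousIdeal.irrelevant 𝒜 :=
          HomogeneousIdeal.mem_irrelevant_of_mem 𝒜 one_pos (MvPolynomial.isHomogeneous_X ℂ 0)
        have h2 : (MvPolynomial.X 0 : MvPolynomial (Fin (N + 1)) ℂ) ∈ (⊥ : Ideal _) := h h1
        exact MvPolynomial.X_ne_zero 0 h2 }
  refine ⟨η, fun U hU x hx => ?_⟩
  have h : x ∈ closure {η} := (ProjectiveSpectrum.le_iff_mem_closure 𝒜 η x).1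
    ((ProjectiveSpectrum.as_ideal_le_as_ideal 𝒜 η x).1 bot_le)
  obtain ⟨y, hy, hy'⟩ := mem_closure_iff.1 h U hU hx
  rwa [← Set.mem_singleton_iff.1 hy']

/-- Some point of projective space lies in every nonempty open set. -/
lemma exists_forall_mem_opens (N : ℕ) :
    ∃ η : PP N, ∀ (U : (PP N).Opens) (x : PP N), x ∈ U → η ∈ U := by
  obtain ⟨η, hη⟩ := exists_forall_mem_isOpen N
  exact ⟨η, fun U x hx => hη (U : Set (PP N)) U.2 x hx⟩

/-- Rank is locally constant, and the neighbourhoods of any two points share the generic point. -/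
lemma finrank_fib_eq {N : ℕ} {M : (PP N).Modules} (hM : IsVectorBundle M) (x y : PP N) :
    Module.finrank (resField x) (fib M x) = Module.finrank (resField y) (fib M y) := by
  obtain ⟨η, hη⟩ := exists_forall_mem_opens N
  obtain ⟨U, hx, hU⟩ := exists_forall_finrank_fib_eq hM x
  obtain ⟨V, hy, hV⟩ := exists_forall_finrank_fib_eq hM y
  rw [← hU η (hη U x hx), ← hV η (hη V y hy)]

end ProjectiveSpace

/-! ### Tensoring with a vector space, on stalks and fibres -/

section TensorFibre

variable {N : ℕ}

/-- The value of a constant function at a point. -/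
def constValue {N : ℕ} (x : PP N) : ℂ →+* resField x :=
  (IsLocalRing.residue _).comp (((PP N).presheaf.germ ⊤ x trivial).hom.comp (constants N))

/-- Complex scalars act on fibres through the residue field at the point, which need not be ℂ since
x may be any scheme point. -/
lemma fibMap_smul {C D : (PP N).Modules} (x : PP N) (c : ℂ) (f : C ⟶ D) :
    fibMap C D x (c • f) = constValue x c • fibMap C D x f := by
  change fibMap C D x (f ≫ globalMul (constants N c) D) = _
  rw [fibMap_comp, fibMap_globalMul]
  rfl

lemma stalkMap_sum {X : Scheme.{0}} {M K : X.Modules} {ι : Type} (s : Finset ι) (f : ι → (M ⟶ K))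
    (x : X) : stalkMap (∑ j ∈ s, f j) x = ∑ j ∈ s, stalkMap (f j) x := by
  classical
  induction s using Finset.induction_on with
  | empty => exact stalkMap_zero _ _ _
  | insert a s ha ih => rw [Finset.sum_insert ha, Finset.sum_insert ha, stalkMap_add, ih]

variable (D : (PP N).Modules) (A : Type) [AddCommGroup A] [Module ℂ A] [FiniteDimensional ℂ A]

/-- The morphism `D ⊗ A → D` given by a linear form on `A`. -/
def tensorCoord (ξ : A →ₗ[ℂ] ℂ) : tensor D A ⟶ D :=
  (tensor_universal D D A (ξ.smulRight (𝟙 D))).choose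

lemma tensorMk_tensorCoord (ξ : A →ₗ[ℂ] ℂ) (a : A) :
    tensorMk D A a ≫ tensorCoord D A ξ = ξ a • 𝟙 D :=
  (tensor_universal D D A (ξ.smulRight (𝟙 D))).choose_spec.1 a

variable {J : Type} (B : Module.Basis J ℂ A)

lemma tensorMk_tensorCoord_basis [DecidableEq J] (j k : J) :
    tensorMk D A (B j) ≫ tensorCoord D A (B.coord k) = if j = k then 𝟙 D else 0 := by
  rw [tensorMk_tensorCoord, Module.Basis.coord_apply, Module.Basis.repr_self,
    Finsupp.single_apply]
  split_ifs
  · exact one_smul ℂ _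
  · exact zero_smul ℂ _

variable {D A} in
lemma tensor_hom_ext {K : (PP N).Modules} {f g : tensor D A ⟶ K}
    (h : ∀ a, tensorMk D A a ≫ f = tensorMk D A a ≫ g) : f = g :=
  (tensor_universal D K A ((Linear.rightComp ℂ D g).comp (tensorMk D A))).unique h fun _ => rfl

lemma sum_tensorCoord_tensorMk [Fintype J] :
    ∑ j, tensorCoord D A (B.coord j) ≫ tensorMk D A (B j) = 𝟙 (tensor D A) := by
  refine tensor_hom_ext fun a => ?_
  rw [Preadditive.comp_sum, Category.comp_id]
  simp only [← Category.assoc, tensorMk_tensorCoord, Linear.smul_comp, Category.id_comp]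
  rw [← B.sum_repr a]
  conv_rhs => rw [B.sum_repr a, ← B.sum_repr a, map_sum]
  simp only [map_smul, B.sum_repr, Module.Basis.coord_apply]

/-- The relations make Q the direct sum of |J| copies of P: the projections isolate the coefficients
of each copy, and the decomposition of the identity gives spanning. -/
lemma isBasis_prod_of_biproduct {R P Q ι : Type*} [Ring R] [AddCommGroup P] [Module R P]
    [AddCommGroup Q] [Module R Q] [Fintype J] [DecidableEq J] [Fintype ι] (i : J → P →ₗ[R] Q)
    (p : J → Q →ₗ[R] P) (h : ∀ j k, p k ∘ₗ i j = if j = k then LinearMap.id else 0)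
    (h' : ∑ j, i j ∘ₗ p j = LinearMap.id) {v : ι → P} (hv : IsBasis R v) :
    IsBasis R fun a : J × ι => i a.1 (v a.2) := by
  constructor
  · rw [Fintype.linearIndependent_iff]
    rintro c hc ⟨k, l⟩
    have h1 := congr(p k $hc)
    rw [Fintype.sum_prod_type, map_zero, map_sum] at h1
    rw [Finset.sum_eq_single k] at h1
    · simp only [map_sum, map_smul] at h1
      simp only [← LinearMap.comp_apply, h, if_true, LinearMap.id_apply] at h1
      exact Fintype.linearIndependent_iff.1 hv.1 (fun l => c (k, l)) h1 l
    · intro j _ hj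
      simp only [map_sum, map_smul]
      simp only [← LinearMap.comp_apply, h, if_neg hj, LinearMap.zero_apply, smul_zero,
        Finset.sum_const_zero]
    · simp
  · rw [eq_top_iff]
    rintro q -
    have h1 := congr($h' q)
    rw [LinearMap.sum_apply] at h1
    rw [LinearMap.id_apply] at h1
    rw [← h1]
    refine Submodule.sum_mem _ fun j _ => ?_
    have h2 : p j q ∈ Submodule.span R (Set.range v) := by rw [hv.2]; trivial
    have h3 := Submodule.mem_map_of_mem (f := i j) h2
    rw [Submodule.map_span] at h3
    refine Submodule.span_mono ?_ h3
    rintro _ ⟨_, ⟨l, rfl⟩, rfl⟩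
    exact ⟨(j, l), rfl⟩

lemma isVectorBundle_tensor (hD : IsVectorBundle D) : IsVectorBundle (tensor D A) := by
  classical
  refine isVectorBundle_of_isStalkFrame fun x => ?_
  obtain ⟨U, hx, r, s, hs⟩ := hD x
  let B := Module.finBasis ℂ A
  refine ⟨U, hx, Fin _ × Fin r, inferInstance, fun a => (tensorMk D A (B a.1)).app U (s a.2),
    fun y hy => ?_⟩
  have := isBasis_prod_of_biproduct (fun j => stalkMap (tensorMk D A (B j)) y)
    (fun j => stalkMap (tensorCoord D A (B.coord j)) y) (fun j k => by
      rw [← stalkMap_comp, tensorMk_tensorCoord_basis]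
      split_ifs
      · exact stalkMap_id _ _
      · exact stalkMap_zero _ _ _) (by
      simp only [← stalkMap_comp]
      rw [← stalkMap_sum, sum_tensorCoord_tensorMk, stalkMap_id]) (hs.isStalkFrame y hy)
  convert this using 1
  ext a
  exact (stalkMap_germ _ _ _ _).symm

lemma fibMap_tensorMk_injective [Fintype J] (x : PP N) {d : J → fib D x}
    (h : ∑ j, fibMap _ _ x (tensorMk D A (B j)) (d j) = 0) (k : J) : d k = 0 := by
  classical
  have h1 := congr(fibMap _ _ x (tensorCoord D A (B.coord k)) $h)
  rw [map_zero, map_sum] at h1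
  simp only [← fibMap_comp_apply, tensorMk_tensorCoord_basis] at h1
  rw [Finset.sum_eq_single k] at h1
  · rwa [if_pos rfl, fibMap_id] at h1
  · intro j _ hj
    rw [if_neg hj, map_zero, LinearMap.zero_apply]
  · simp

lemma exists_eq_sum_fibMap_tensorMk [Fintype J] (x : PP N) (v : fib (tensor D A) x) :
    ∃ d : J → fib D x, v = ∑ j, fibMap _ _ x (tensorMk D A (B j)) (d j) := by
  refine ⟨fun j => fibMap _ _ x (tensorCoord D A (B.coord j)) v, ?_⟩
  simp only [← fibMap_comp_apply]
  rw [← LinearMap.sum_apply, ← map_sum, sum_tensorCoord_tensorMk, fibMap_id]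
  rfl

lemma finrank_fib_tensor (hD : IsVectorBundle D) (x : PP N) :
    Module.finrank (resField x) (fib (tensor D A) x) =
      Module.finrank ℂ A * Module.finrank (resField x) (fib D x) := by
  let B := Module.finBasis ℂ A
  have := finite_fib hD x
  let f : (Fin (Module.finrank ℂ A) → fib D x) →ₗ[resField x] fib (tensor D A) x :=
    ∑ j, fibMap _ _ x (tensorMk D A (B j)) ∘ₗ LinearMap.proj j
  have hf (d) : f d = ∑ j, fibMap _ _ x (tensorMk D A (B j)) (d j) := by
    simp [f, LinearMap.sum_apply]
  have hbij : Function.Bijective f := by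
    constructor
    · refine LinearMap.ker_eq_bot.1 (LinearMap.ker_eq_bot'.2 fun d hd => ?_)
      ext1 k
      exact fibMap_tensorMk_injective D A B x ((hf d).symm.trans hd) k
    · intro v
      obtain ⟨d, hd⟩ := exists_eq_sum_fibMap_tensorMk D A B x v
      exact ⟨d, (hf d).trans hd.symm⟩
  rw [← (LinearEquiv.ofBijective f hbij).finrank_eq, Module.finrank_pi_fintype]
  simp

end TensorFibre

/-! ### Recursive construction of the pairs (C_n, C_{n+1}) -/

section Contraction

variable {N : ℕ}

/-- For `θ : A → Hom(C, D)` and `t = ∑ a ⊗ b` in `A ⊗ B`, the morphism `C → D ⊗ B`,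
`c ↦ ∑ θ(a)(c) ⊗ b`. -/
def contraction {C D : (PP N).Modules} {A B : Type} [AddCommGroup A] [Module ℂ A]
    [AddCommGroup B] [Module ℂ B] [FiniteDimensional ℂ B]
    (θ : A →ₗ[ℂ] (C ⟶ D)) (t : A ⊗[ℂ] B) : C ⟶ tensor D B :=
  TensorProduct.lift
    ((CategoryTheory.Linear.comp (S := ℂ) C D (tensor D B)).compl₁₂ θ (tensorMk D B)) t

lemma contraction_sum {C D : (PP N).Modules} {A B : Type} [AddCommGroup A] [Module ℂ A]
    [AddCommGroup B] [Module ℂ B] [FiniteDimensional ℂ B]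
    (θ : A →ₗ[ℂ] (C ⟶ D)) {J : Type} [Fintype J] (a : J → A) (b : J → B) :
    contraction θ (∑ j, a j ⊗ₜ b j) = ∑ j, θ (a j) ≫ tensorMk D B (b j) := by
  rw [contraction, map_sum]
  rfl

/-- Identifies the recursion (p ⊗ id) ∘ (id ⊗ d) with contraction against the action that p induces
on C, the form used to build the sequence. -/
lemma tensorElement_tensorMap (C : (PP N).Modules) {D : (PP N).Modules} {A B : Type}
    [AddCommGroup A] [Module ℂ A] [FiniteDimensional ℂ A] [AddCommGroup B] [Module ℂ B]
    [FiniteDimensional ℂ B] (t : A ⊗[ℂ] B) (p : tensor C A ⟶ D) :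
    tensorElement C t ≫ tensorMap p B =
      contraction ((Linear.rightComp ℂ C p).comp (tensorMk C A)) t := by
  induction t using TensorProduct.induction_on with
  | zero =>
    rw [tensorElement, contraction, map_zero, map_zero, zero_comp]
  | tmul a b =>
    change (tensorMk C A a ≫ tensorMk (tensor C A) B b) ≫ tensorMap p B =
      (tensorMk C A a ≫ p) ≫ tensorMk D B b
    rw [Category.assoc, tensorMk_tensorMap, Category.assoc]
  | add t u ht hu =>
    rw [tensorElement, contraction, map_add, map_add, Preadditive.add_comp]
    exact congr($ht + $hu)

lemma tensorMap_id (C : (PP N).Modules) (A : Type) [AddCommGroup A] [Module ℂ A]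
    [FiniteDimensional ℂ A] : tensorMap (𝟙 C) A = 𝟙 _ :=
  tensor_hom_ext fun a => by rw [tensorMk_tensorMap, Category.id_comp, Category.comp_id]

variable (E F : (PP N).Modules) [FiniteDimensional ℂ (E ⟶ F)]

open Classical in
/-- Bases of the spaces `W, W*, W, …`, each dual to the next. -/
def mutBasis : ∀ n, Module.Basis (Module.Basis.ofVectorSpaceIndex ℂ (E ⟶ F)) ℂ (mutSpace E F n)
  | 0 => Module.Basis.ofVectorSpace ℂ (E ⟶ F)
  | 1 => (Module.Basis.ofVectorSpace ℂ (E ⟶ F)).dualBasis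
  | n + 2 => mutBasis n

lemma diagonal_eq_sum : ∀ n, diagonal E F n = ∑ j, mutBasis E F n j ⊗ₜ mutBasis E F (n + 1) j
  | 0 => by
    refine (coevaluation_apply_one ℂ (E ⟶ F)).trans ?_
    refine Finset.sum_congr rfl fun j _ => ?_
    congr 1
    classical
    exact congrFun (Module.Basis.coe_dualBasis (Module.Basis.ofVectorSpace ℂ (E ⟶ F))).symm j
  | 1 => by
    refine (congrArg _ (coevaluation_apply_one ℂ (E ⟶ F))).trans ?_
    rw [map_sum]
    refine Finset.sum_congr rfl fun j _ => ?_
    rw [TensorProduct.comm_tmul]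
    congr 1
    classical
    exact congrFun (Module.Basis.coe_dualBasis (Module.Basis.ofVectorSpace ℂ (E ⟶ F))).symm j
  | n + 2 => diagonal_eq_sum n

/-- A pair of `𝒪`-modules together with a space of morphisms between them. -/
structure MutPair (N : ℕ) (A : Type) [AddCommGroup A] [Module ℂ A] where
  src : (PP N).Modules
  tgt : (PP N).Modules
  act : A →ₗ[ℂ] (src ⟶ tgt)

/-- The pairs `(C_n, C_{n+1})` with the action of `W` or `W*`. -/
def mutPair : ∀ n, MutPair N (mutSpace E F n)
  | 0 => ⟨E, F, LinearMap.id⟩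
  | n + 1 =>
    ⟨(mutPair n).tgt, cokernel (contraction (mutPair n).act (diagonal E F n)),
      (Linear.rightComp ℂ _ (cokernel.π (contraction (mutPair n).act (diagonal E F n)))).comp
        (tensorMk (mutPair n).tgt (mutSpace E F (n + 1)))⟩

/-- The map `i_{n+1}` from `C_n` to `C_{n+1} ⊗ W` or `C_{n+1} ⊗ W*`. -/
def mutInj (n : ℕ) : (mutPair E F n).src ⟶ tensor (mutPair E F n).tgt (mutSpace E F (n + 1)) :=
  contraction (mutPair E F n).act (diagonal E F n)

lemma mutInj_eq_sum (n : ℕ) : mutInj E F n =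
    ∑ j, (mutPair E F n).act (mutBasis E F n j) ≫ tensorMk _ _ (mutBasis E F (n + 1) j) := by
  rw [mutInj, diagonal_eq_sum, contraction_sum]

end Contraction

/-! ### Global generation and the maps between fibres -/

section GlobalGeneration

variable {X : Scheme.{0}}

/-- A compatible family of linear maps on the sections over the open subsets of `U` defines a
morphism between the restrictions to `U`. -/
def restrictHom {M K : X.Modules} (U : X.Opens)
    (ψ : ∀ V : X.Opens, V ≤ U → (Γ(M, V) →ₗ[Γ(X, V)] Γ(K, V)))
    (hψ : ∀ (V : X.Opens) (hV : V ≤ U) (W : X.Opens) (hW : W ≤ V) (s : Γ(M, V)),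
      ψ W (hW.trans hV) (res hW s) = res hW (ψ V hV s)) :
    M.restrict U.ι ⟶ K.restrict U.ι :=
  (Scheme.Modules.fullyFaithfulToPresheafOfModules (X := (U : Scheme.{0}))).preimage
    { app := fun V => ModuleCat.ofHom
        (X := (M.restrict U.ι).val.obj V) (Y := (K.restrict U.ι).val.obj V)
        { toFun := fun s => ψ (U.ι ''ᵁ V.unop) (U.ι_image_le _) s
          map_add' := fun s t => map_add (ψ (U.ι ''ᵁ V.unop) (U.ι_image_le _)) s t
          map_smul' := fun a s =>
            -- Functions on an open set of the subscheme act through the corresponding functions on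
            -- its image in X.
            (ψ (U.ι ''ᵁ V.unop) (U.ι_image_le _)).map_smul ((U.ι.appIso V.unop).inv a)
              (show Γ(M, U.ι ''ᵁ V.unop) from s) }
      naturality := by
        intro V W f
        ext s
        exact hψ (U.ι ''ᵁ V.unop) (U.ι_image_le _) (U.ι ''ᵁ W.unop)
          (Scheme.Hom.image_mono _ f.unop.le) s }

lemma exists_sum_smul_eq_of_globallyGenerated {M K : X.Modules}
    (h : DualTensorGloballyGenerated M K) {U : X.Opens}
    (ψ : ∀ V : X.Opens, V ≤ U → (Γ(M, V) →ₗ[Γ(X, V)] Γ(K, V)))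
    (hψ : ∀ (V : X.Opens) (hV : V ≤ U) (W : X.Opens) (hW : W ≤ V) (s : Γ(M, V)),
      ψ W (hW.trans hV) (res hW s) = res hW (ψ V hV s)) {x : X} (hx : x ∈ U) :
    ∃ (W : X.Opens) (hW : W ≤ U) (_ : x ∈ W) (m : ℕ) (f : Fin m → (M ⟶ K))
      (g : Fin m → Γ(X, W)), ∀ s, ψ W hW s = ∑ j, g j • (f j).app W s := by
  obtain ⟨V, hV, m, f, g, hg⟩ := h U (restrictHom U ψ hψ) ⟨x, hx⟩
  refine ⟨U.ι ''ᵁ V, U.ι_image_le _, ⟨⟨x, hx⟩, hV, rfl⟩, m, f,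
    fun j => (U.ι.appIso V).inv (resFun le_rfl (g j)), fun s => ?_⟩
  exact hg V le_rfl s

/-- The `i`-th coordinate with respect to a frame, times a fixed section. -/
def frameMap {M K : X.Modules} {U : X.Opens} {r : ℕ} {s : Fin r → Γ(M, U)} (hs : IsFrame s)
    (i : Fin r) (t : Γ(K, U)) (V : X.Opens) (hV : V ≤ U) : Γ(M, V) →ₗ[Γ(X, V)] Γ(K, V) :=
  (IsBasis.basis (v := fun j => res hV (s j)) (hs V hV)).coord i |>.smulRight (res hV t)

lemma frameMap_sum_smul {M K : X.Modules} {U : X.Opens} {r : ℕ} {s : Fin r → Γ(M, U)}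
    (hs : IsFrame s) (i : Fin r) (t : Γ(K, U)) (V : X.Opens) (hV : V ≤ U) (c : Fin r → Γ(X, V)) :
    frameMap hs i t V hV (∑ j, c j • res hV (s j)) = c i • res hV t := by
  rw [frameMap, LinearMap.smulRight_apply, Module.Basis.coord_apply,
    IsBasis.repr_sum_smul (v := fun j => res hV (s j)) (hs V hV)]

lemma frameMap_res_frame {M K : X.Modules} {U : X.Opens} {r : ℕ} {s : Fin r → Γ(M, U)}
    (hs : IsFrame s) (i : Fin r) (t : Γ(K, U)) (V : X.Opens) (hV : V ≤ U) (a : Fin r) :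
    frameMap hs i t V hV (res hV (s a)) = if a = i then res hV t else 0 := by
  have h := frameMap_sum_smul hs i t V hV (Pi.single a 1)
  rw [Finset.sum_eq_single a (fun b _ hb => by rw [Pi.single_eq_of_ne hb, zero_smul]) (by simp),
    Pi.single_eq_same, one_smul] at h
  rw [h]
  split_ifs with hai
  · rw [hai, Pi.single_eq_same, one_smul]
  · rw [Pi.single_eq_of_ne (Ne.symm hai), zero_smul]

lemma frameMap_res {M K : X.Modules} {U : X.Opens} {r : ℕ} {s : Fin r → Γ(M, U)}
    (hs : IsFrame s) (i : Fin r) (t : Γ(K, U)) (V : X.Opens) (hV : V ≤ U) (W : X.Opens)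
    (hW : W ≤ V) (m : Γ(M, V)) :
    frameMap hs i t W (hW.trans hV) (res hW m) = res hW (frameMap hs i t V hV m) := by
  obtain ⟨c, rfl⟩ := (hs.isStalkFrame.res hV).exists_eq_sum_smul m
  rw [res_sum_smul, frameMap_sum_smul, res_smul]
  simp only [res_res]
  rw [frameMap_sum_smul]

/-- If `ℋom(E, F)` is globally generated, then global morphisms span the maps between fibres. -/
lemma span_range_fibMap_eq_top {M K : X.Modules} (hM : IsVectorBundle M) (hK : IsVectorBundle K)
    (h : DualTensorGloballyGenerated M K) (x : X) :
    Submodule.span (resField x) (Set.range (fibMap M K x)) = ⊤ := by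
  classical
  obtain ⟨U₁, h₁, r, s', hs'⟩ := hM x
  obtain ⟨U₂, h₂, n, t', ht'⟩ := hK x
  have hx : x ∈ U₁ ⊓ U₂ := ⟨h₁, h₂⟩
  have hs := (hs'.isStalkFrame.res (inf_le_left : U₁ ⊓ U₂ ≤ U₁)).isFrame
  have ht := (ht'.isStalkFrame.res (inf_le_right : U₁ ⊓ U₂ ≤ U₂)).isFrame
  set s := fun j => res (inf_le_left : U₁ ⊓ U₂ ≤ U₁) (s' j)
  set t := fun j => res (inf_le_right : U₁ ⊓ U₂ ≤ U₂) (t' j)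
  let b := (isBasis_value hs.isStalkFrame x hx).basis
  let d := (isBasis_value ht.isStalkFrame x hx).basis
  have hb (a) : b a = value (s a) x hx := IsBasis.basis_apply _ a
  have hd (k) : d k = value (t k) x hx := IsBasis.basis_apply _ k
  -- Elementary matrices suffice. Each is the value at x of a local morphism `frameMap`, which
  -- global generation writes near x as a combination of global morphisms.
  have key : ∀ i k, (b.coord i).smulRight (d k) ∈
      Submodule.span (resField x) (Set.range (fibMap M K x)) := by
    intro i k
    obtain ⟨W, hW, hxW, m, f, g, hg⟩ := exists_sum_smul_eq_of_globallyGenerated h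
      (frameMap hs i (t k)) (frameMap_res hs i (t k)) hx
    have : (b.coord i).smulRight (d k) = ∑ l,
        IsLocalRing.residue _ ((X.presheaf.germ W x hxW) (g l)) • fibMap M K x (f l) := by
      refine b.ext fun a => ?_
      have h3 := congr(value $(hg (res hW (s a))) x hxW)
      rw [frameMap_res_frame, value_sum_smul] at h3
      simp only [← fibMap_value, value_res] at h3
      rw [LinearMap.sum_apply]
      simp only [LinearMap.smul_apply, hb]
      rw [← h3, LinearMap.smulRight_apply, Module.Basis.coord_apply, ← hb,
        Module.Basis.repr_self, Finsupp.single_apply]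
      split_ifs
      · rw [one_smul, value_res, hd]
      · rw [zero_smul, value, germ, map_zero, TensorProduct.tmul_zero]
    rw [this]
    exact Submodule.sum_mem _ fun l _ => Submodule.smul_mem _ _ (Submodule.subset_span ⟨_, rfl⟩)
  rw [eq_top_iff]
  rintro T -
  have : T = ∑ i, ∑ k, d.repr (T (b i)) k • (b.coord i).smulRight (d k) := by
    refine b.ext fun a => ?_
    simp only [LinearMap.sum_apply, LinearMap.smul_apply, LinearMap.smulRight_apply,
      Module.Basis.coord_apply, Module.Basis.repr_self, Finsupp.single_apply]
    rw [Finset.sum_eq_single a]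
    · simp only [if_true, one_smul]
      exact (d.sum_repr _).symm
    · intro i _ hi
      simp [hi.symm]
    · simp
  rw [this]
  exact Submodule.sum_mem _ fun i _ => Submodule.sum_mem _ fun k _ =>
    Submodule.smul_mem _ _ (key i k)

lemma span_range_fibMap_comp_basis {N : ℕ} {E F : (PP N).Modules} {J : Type} [Fintype J]
    (B : Module.Basis J ℂ (E ⟶ F)) (x : PP N)
    (h : Submodule.span (resField x) (Set.range (fibMap E F x)) = ⊤) :
    Submodule.span (resField x) (Set.range fun j => fibMap E F x (B j)) = ⊤ := by
  rw [eq_top_iff, ← h, Submodule.span_le]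
  rintro _ ⟨f, rfl⟩
  rw [← B.sum_repr f, map_sum]
  simp only [fibMap_smul]
  exact Submodule.sum_mem _ fun j _ => Submodule.smul_mem _ _ (Submodule.subset_span ⟨j, rfl⟩)

/-- The space of linear maps from the fibre of E to that of F has dimension the product of the
ranks, and it is spanned by the images of a basis of W. -/
lemma finrank_fib_mul_finrank_fib_le {N : ℕ} {E F : (PP N).Modules} [FiniteDimensional ℂ (E ⟶ F)]
    (hE : IsVectorBundle E) (hF : IsVectorBundle F) (h : DualTensorGloballyGenerated E F)
    (x : PP N) :
    Module.finrank (resField x) (fib E x) * Module.finrank (resField x) (fib F x) ≤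
      Module.finrank ℂ (E ⟶ F) := by
  have := finite_fib hE x
  have := finite_fib hF x
  have h1 := span_range_fibMap_comp_basis (Module.finBasis ℂ (E ⟶ F)) x
    (span_range_fibMap_eq_top hE hF h x)
  rw [← Module.finrank_linearMap (resField x) (resField x), ← finrank_top, ← h1]
  exact (finrank_range_le_card _).trans (by simp)

end GlobalGeneration

/-! ### Fibrewise exactness, injectivity and the resulting bundles -/

section Mutation

variable {N : ℕ} (E F : (PP N).Modules) [FiniteDimensional ℂ (E ⟶ F)]

/-- The projection `p_{n+1}` onto the cokernel `C_{n+2}`. -/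
def mutProj (n : ℕ) :
    tensor (mutPair E F n).tgt (mutSpace E F (n + 1)) ⟶ (mutPair E F (n + 1)).tgt :=
  cokernel.π (mutInj E F n)

instance (n : ℕ) : Epi (mutProj E F n) := inferInstanceAs (Epi (cokernel.π _))

/-- The sequence `C_n → C_{n+1} ⊗ W → C_{n+2}`, with `W*` in place of `W` for even `n`. -/
def mutComplex (n : ℕ) : ShortComplex (PP N).Modules :=
  ShortComplex.mk (mutInj E F n) (mutProj E F n) (cokernel.condition _)

lemma mutComplex_exact (n : ℕ) : (mutComplex E F n).Exact :=
  ShortComplex.exact_cokernel (mutInj E F n)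

/-- The maps between fibres given by the elements of the chosen bases of `W`, resp. `W*`. -/
def mutFibMap (x : PP N) (n : ℕ) (j : Module.Basis.ofVectorSpaceIndex ℂ (E ⟶ F)) :
    fib (mutPair E F n).src x →ₗ[resField x] fib (mutPair E F n).tgt x :=
  fibMap _ _ x ((mutPair E F n).act (mutBasis E F n j))

lemma fibMap_mutInj (x : PP N) (n : ℕ) (c : fib (mutPair E F n).src x) :
    fibMap _ _ x (mutInj E F n) c =
      ∑ j, fibMap _ _ x (tensorMk _ _ (mutBasis E F (n + 1) j)) (mutFibMap E F x n j c) := by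
  rw [mutInj_eq_sum, map_sum, LinearMap.sum_apply]
  simp only [fibMap_comp_apply]
  rfl

/-- Together with `fibMap_mutInj` this shows that the same maps T_{n,j} describe the injection out
of C_n and the preceding projection onto C_n; this links consecutive sequences. -/
lemma fibMap_mutProj (x : PP N) (n : ℕ)
    (d : Module.Basis.ofVectorSpaceIndex ℂ (E ⟶ F) → fib (mutPair E F n).tgt x) :
    fibMap _ _ x (mutProj E F n)
        (∑ j, fibMap _ _ x (tensorMk _ _ (mutBasis E F (n + 1) j)) (d j)) =
      ∑ j, mutFibMap E F x (n + 1) j (d j) := by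
  rw [map_sum]
  simp only [← fibMap_comp_apply]
  rfl

lemma injective_fibMap_mutInj_iff (x : PP N) (n : ℕ) :
    Function.Injective (fibMap _ _ x (mutInj E F n)) ↔
      ∀ c, (∀ j, mutFibMap E F x n j c = 0) → c = 0 := by
  rw [← LinearMap.ker_eq_bot, LinearMap.ker_eq_bot']
  refine forall_congr' fun c => imp_congr_left ?_
  rw [fibMap_mutInj]
  refine ⟨fun h => fibMap_tensorMk_injective _ _ (mutBasis E F (n + 1)) x h, fun h => ?_⟩
  exact Finset.sum_eq_zero fun j _ => by rw [h j, map_zero]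

/-- Right exactness of the fibre, read in coordinates. It needs neither injectivity nor local
freeness of the cokernels. -/
lemma exists_mutFibMap_eq (x : PP N) (n : ℕ)
    (d : Module.Basis.ofVectorSpaceIndex ℂ (E ⟶ F) → fib (mutPair E F n).tgt x)
    (hd : ∑ j, mutFibMap E F x (n + 1) j (d j) = 0) : ∃ c, ∀ j, mutFibMap E F x n j c = d j := by
  rw [← fibMap_mutProj] at hd
  have : Epi (mutComplex E F n).g := inferInstanceAs (Epi (mutProj E F n))
  obtain ⟨c, hc⟩ := (exact_fibMap (mutComplex_exact E F n) x _).1 hd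
  change fib (mutPair E F n).src x at c
  change fibMap _ _ x (mutInj E F n) c = _ at hc
  refine ⟨c, fun j => sub_eq_zero.1 ?_⟩
  refine fibMap_tensorMk_injective _ _ (mutBasis E F (n + 1)) x
    (d := fun j => mutFibMap E F x n j c - d j) ?_ j
  simp only [map_sub, Finset.sum_sub_distrib]
  rw [sub_eq_zero, ← fibMap_mutInj]
  exact hc

/-- Each new fibre is a quotient of finitely many copies of the previous one. Finiteness is obtained
this way because local freeness of the later terms is deduced from the injectivity that uses it. -/
lemma finite_fib_mutPair (hE : IsVectorBundle E) (hF : IsVectorBundle F) (x : PP N) (n : ℕ) :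
    Module.Finite (resField x) (fib (mutPair E F n).src x) ∧
      Module.Finite (resField x) (fib (mutPair E F n).tgt x) := by
  induction n with
  | zero => exact ⟨finite_fib hE x, finite_fib hF x⟩
  | succ n ih =>
    refine ⟨ih.2, ?_⟩
    have := ih.2
    let f : (Module.Basis.ofVectorSpaceIndex ℂ (E ⟶ F) → fib (mutPair E F n).tgt x)
        →ₗ[resField x] fib (mutPair E F (n + 1)).tgt x :=
      ∑ j, mutFibMap E F x (n + 1) j ∘ₗ LinearMap.proj j
    refine Module.Finite.of_surjective f fun v => ?_
    obtain ⟨v, rfl⟩ := surjective_fibMap (mutProj E F n) x v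
    obtain ⟨d, rfl⟩ := exists_eq_sum_fibMap_tensorMk _ _ (mutBasis E F (n + 1)) x v
    refine ⟨d, ?_⟩
    rw [fibMap_mutProj, LinearMap.sum_apply]
    rfl

variable {E F}

lemma card_ofVectorSpaceIndex_eq_finrank :
    Fintype.card (Module.Basis.ofVectorSpaceIndex ℂ (E ⟶ F)) = Module.finrank ℂ (E ⟶ F) :=
  (Module.finrank_eq_card_basis (Module.Basis.ofVectorSpace ℂ (E ⟶ F))).symm

lemma IsSimple.id_ne_zero {M : (PP N).Modules} (hM : IsSimple M) : 𝟙 M ≠ 0 := by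
  intro h
  have : Subsingleton (M ⟶ M) := ⟨fun f g => by
    rw [← Category.comp_id f, ← Category.comp_id g, h, comp_zero, comp_zero]⟩
  rw [IsSimple, Module.finrank_zero_of_subsingleton] at hM
  exact zero_ne_one hM

/-- A simple bundle is nonzero, and on projective space the rank is constant, so it vanishes
nowhere. -/
lemma IsSimple.finrank_fib_pos {M : (PP N).Modules} (hM : IsSimple M) (hM' : IsVectorBundle M)
    (x : PP N) : 0 < Module.finrank (resField x) (fib M x) := by
  refine Nat.pos_of_ne_zero fun h => hM.id_ne_zero ?_
  exact eq_zero_of_finrank_fib_eq_zero hM' (fun y => (finrank_fib_eq hM' y x).trans h) _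

namespace BasicHypotheses

/-- For c ≠ 0 in the fibre of E there is a rank-one map ξ(·)v to the fibre of F that does not kill
c. This map is a combination of elements of W, so they cannot all kill c. -/
lemma injective_fibMap_mutInj_zero (h : BasicHypotheses E F) (x : PP N) :
    Function.Injective (fibMap _ _ x (mutInj E F 0)) := by
  rw [injective_fibMap_mutInj_iff]
  intro (c : fib E x) hc
  by_contra hne
  have := finite_fib h.bundle_right x
  have hpos := h.simple_right.finrank_fib_pos h.bundle_right x
  obtain ⟨v, hv⟩ := (Module.finrank_pos_iff_exists_ne_zero (R := resField x)).1 hpos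
  obtain ⟨ξ, hξ⟩ := Module.Projective.exists_dual_ne_zero (resField x) hne
  have h1 := span_range_fibMap_comp_basis (Module.Basis.ofVectorSpace ℂ (E ⟶ F)) x
    (span_range_fibMap_eq_top h.bundle_left h.bundle_right h.globally_generated x)
  have h2 : ξ.smulRight v ∈ Submodule.span (resField x) (Set.range fun j =>
      fibMap E F x (Module.Basis.ofVectorSpace ℂ (E ⟶ F) j)) := by rw [h1]; trivial
  have h3 : Submodule.span (resField x) (Set.range fun j =>
      fibMap E F x (Module.Basis.ofVectorSpace ℂ (E ⟶ F) j)) ≤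
        LinearMap.ker (LinearMap.applyₗ c) := by
    rw [Submodule.span_le]
    rintro _ ⟨j, rfl⟩
    exact hc j
  exact (smul_ne_zero hξ hv) (h3 h2)

lemma finrank_fib_left_lt (h : BasicHypotheses E F) (x : PP N) :
    Module.finrank (resField x) (fib E x) < Module.finrank ℂ (E ⟶ F) := by
  by_contra! hle
  have h3 := h.three_le_dim
  have hpos := h.simple_right.finrank_fib_pos h.bundle_right x
  have hmul := finrank_fib_mul_finrank_fib_le h.bundle_left h.bundle_right h.globally_generated x
  -- If rk F ≥ 2, then 2 rk E ≤ w ≤ rk E, impossible as w ≥ 3; and rk F > 0 since F is simple.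
  have hF1 : Module.finrank (resField x) (fib F x) = 1 := by nlinarith
  have hE1 : Module.finrank (resField x) (fib E x) = Module.finrank ℂ (E ⟶ F) := by
    rw [hF1] at hmul; omega
  have htensor := isVectorBundle_tensor F (mutSpace E F 1) h.bundle_right
  have hmono : Mono (mutInj E F 0) :=
    mono_of_injective_fibMap h.bundle_left htensor _ h.injective_fibMap_mutInj_zero
  have : Epi (mutComplex E F 0).g := inferInstanceAs (Epi (mutProj E F 0))
  have hQ : IsVectorBundle (mutPair E F 1).tgt :=
    isVectorBundle_of_exact (mutComplex_exact E F 0) h.bundle_left htensor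
      h.injective_fibMap_mutInj_zero
  -- Source and target of i_1 now have equal rank, so i_1 is bijective on every fibre and its
  -- cokernel is a bundle of rank zero.
  have hzero : mutProj E F 0 = 0 := by
    refine eq_zero_of_finrank_fib_eq_zero hQ (fun y => ?_) _
    have := finite_fib h.bundle_left y
    have := finite_fib htensor y
    have hdim : Module.finrank (resField y) (fib E y) =
        Module.finrank (resField y) (fib (tensor F (mutSpace E F 1)) y) := by
      rw [finrank_fib_tensor _ _ h.bundle_right, finrank_fib_eq h.bundle_right y x, hF1, mul_one,
        finrank_fib_eq h.bundle_left y x, hE1]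
      exact (Subspace.dual_finrank_eq (K := ℂ) (V := E ⟶ F)).symm
    have hsurj := (LinearMap.injective_iff_surjective_of_finrank_eq_finrank hdim).1
      (h.injective_fibMap_mutInj_zero y)
    have : Subsingleton (fib (mutPair E F 1).tgt y) := by
      refine subsingleton_of_forall_eq 0 fun q => ?_
      obtain ⟨v, rfl⟩ := surjective_fibMap (mutProj E F 0) y q
      obtain ⟨c, rfl⟩ := hsurj v
      exact (exact_fibMap (mutComplex_exact E F 0) y).apply_apply_eq_zero c
    exact Module.finrank_zero_of_subsingleton
  have : Epi (mutInj E F 0) := Preadditive.epi_of_cokernel_zero hzero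
  have : IsIso (mutInj E F 0) := isIso_of_mono_of_epi _
  have hpos' : 0 < Fintype.card (Module.Basis.ofVectorSpaceIndex ℂ (E ⟶ F)) := by
    rw [card_ofVectorSpaceIndex_eq_finrank]; omega
  obtain ⟨j⟩ := Fintype.card_pos_iff.1 hpos'
  classical
  have h1 := tensorMk_tensorCoord_basis F (mutSpace E F 1) (mutBasis E F 1) j j
  let e := asIso (mutInj E F 0)
  obtain ⟨ψ, hψ⟩ : ∃ ψ : tensor F (mutSpace E F 1) ⟶ E, Mono ψ :=
    ⟨e.inv, inferInstanceAs (Mono e.inv)⟩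
  -- Composed with the inverse of i_1, the inclusion of a copy of F in F ⊗ W* is a map F → E, hence
  -- zero. But this inclusion has a retraction, which would make the identity of F zero.
  have h2 : tensorMk F (mutSpace E F 1) (mutBasis E F 1 j) = 0 := by
    rw [← cancel_mono ψ, h.hom_eq_zero (_ ≫ ψ), zero_comp]
  rw [h2, zero_comp, if_pos rfl] at h1
  exact h.simple_right.id_ne_zero h1.symm

/-- The first map is handled by global generation; all later ones follow from the dimension count
and rk E < w. -/
lemma injective_fibMap_mutInj (h : BasicHypotheses E F) (n : ℕ) (x : PP N) :
    Function.Injective (fibMap _ _ x (mutInj E F n)) := by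
  cases n with
  | zero => exact h.injective_fibMap_mutInj_zero x
  | succ n =>
    rw [injective_fibMap_mutInj_iff]
    have := fun n => (finite_fib_mutPair E F h.bundle_left h.bundle_right x n).1
    refine eq_zero_of_forall_eq_zero_of_exact (K := resField x)
      (card_ofVectorSpaceIndex_eq_finrank (E := E) (F := F) ▸ h.three_le_dim)
      (fun n => fib (mutPair E F n).src x) (mutFibMap E F x) n
      (fun k _ d hd => exists_mutFibMap_eq E F x k d hd) ?_
    rw [card_ofVectorSpaceIndex_eq_finrank]
    exact h.finrank_fib_left_lt x

lemma isVectorBundle_mutPair (h : BasicHypotheses E F) (n : ℕ) :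
    IsVectorBundle (mutPair E F n).src ∧ IsVectorBundle (mutPair E F n).tgt := by
  induction n with
  | zero => exact ⟨h.bundle_left, h.bundle_right⟩
  | succ n ih =>
    have : Epi (mutComplex E F n).g := inferInstanceAs (Epi (mutProj E F n))
    exact ⟨ih.2, isVectorBundle_of_exact (mutComplex_exact E F n) ih.1
      (isVectorBundle_tensor _ _ ih.2) (h.injective_fibMap_mutInj n)⟩

lemma shortExact_mutComplex (h : BasicHypotheses E F) (n : ℕ) : (mutComplex E F n).ShortExact where
  exact := mutComplex_exact E F n
  mono_f := mono_of_injective_fibMap (h.isVectorBundle_mutPair n).1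
    (isVectorBundle_tensor _ _ (h.isVectorBundle_mutPair n).2) _ (h.injective_fibMap_mutInj n)
  epi_g := inferInstanceAs (Epi (mutProj E F n))

end BasicHypotheses

end Mutation

end

end FibonacciBundle

open FibonacciBundle in
theorem mainTheorem7 (N : ℕ) (hN : 2 ≤ N) (E F : (PP N).Modules)
    [FiniteDimensional ℂ (E ⟶ F)] (h : BasicHypotheses E F) :
    ∃ (C : ℕ → (PP N).Modules) (h₀ : C 0 = E) (h₁ : C 1 = F)
      -- `i n` and `p n` are the maps `i_{n+1}` and `p_{n+1}`; `mutSpace E F (n + 1)` is `W*` if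
      -- `n + 1` is odd and `W` if `n + 1` is even
      (i : ∀ n, C n ⟶ tensor (C (n + 1)) (mutSpace E F (n + 1)))
      (p : ∀ n, tensor (C (n + 1)) (mutSpace E F (n + 1)) ⟶ C (n + 2)),
      (∀ n, IsVectorBundle (C n)) ∧
      (∀ n, ∃ w : i n ≫ p n = 0, (ShortComplex.mk (i n) (p n) w).ShortExact) ∧
      (i 0 = eqToHom h₀ ≫ canonicalMap E F ≫ tensorMap (eqToHom h₁.symm) (mutSpace E F 1)) ∧
      (∀ n, i (n + 1) =
        tensorElement (C (n + 1)) (diagonal E F (n + 1)) ≫ tensorMap (p n) (mutSpace E F (n + 2))) ∧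
      (∀ n, IsInjectiveBundleMap (i n)) := by
  refine ⟨fun n => (mutPair E F n).src, rfl, rfl, mutInj E F, mutProj E F,
    fun n => (h.isVectorBundle_mutPair n).1,
    fun n => ⟨cokernel.condition _, h.shortExact_mutComplex n⟩, ?_, fun n => ?_, fun n => ?_⟩
  -- The identifications of C 0 with E and of C 1 with F hold by definition, so both `eqToHom` are
  -- identities.
  · change mutInj E F 0 = 𝟙 E ≫ canonicalMap E F ≫ tensorMap (𝟙 F) (mutSpace E F 1)
    rw [Category.id_comp]
    exact ((congrArg (canonicalMap E F ≫ ·) (tensorMap_id F (mutSpace E F 1))).trans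
      (Category.comp_id _)).symm
  · exact (tensorElement_tensorMap _ (diagonal E F (n + 1)) (mutProj E F n)).symm
  · exact isInjectiveBundleMap_of_injective (h.isVectorBundle_mutPair n).1
      (h.injective_fibMap_mutInj n)
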